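/- **Setting.** Let $E/F$ be a finite extension of function fields of one variable over a finite field $\mathbb F_q$, both with full constant field $\mathbb F_q$, of degree $m=[E:F]$. Let $y\in E$, let $P_\infty$ be a place of $E$, let $Q_\infty=P_\infty\cap F$, and suppose: 1. $E/F$ is abelian and $E=F(y)$; 2. for every $\sigma\in G=\mathrm{Gal}(E/F)$ there are $a\in\mathbb F_q^*$, $b\in\mathbb F_q$ with $\sigma(y)=ay+b$; 3. $P_\infty$ is rational and totally ramified in $E/F$; 4. $\gcd(m,\nu_{P_\infty}(y))=1$, and for every place $Q\ne Q_\infty$ of $F$ the family $1,y,\dots,y^{m-1}$ is an integral basis of $E/F$ at $Q$. Let $m=\prod_{i=1}^r p_i$ with primes $p_i\le B$, where $B>0$ is real. Let $\mathcal Q\not\ni Q_\infty$ be a finite set of $s$ rational places of $F$ that split completely in $E/F$, let $\mathcal P$ be the set of places of $E$ over places in $\mathcal Q$, and $N=|\mathcal P|$. Let $\lambda\ge 1$ be an integer with $\dim_{\mathbb F_q}\mathcal L(\lambda P_\infty)\le N$. For $j$ in the Weierstrass semigroup $H(Q_\infty)$ let $t_j\in F$ have pole divisor $jQ_\infty$.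 For a chain of subgroups $1=G_0\le G_1\le\dots\le G_r=G$ with $[G_k:G_{k-1}]=p_k$ put $E_k=E^{G_k}$ and $y_k=\prod_{\sigma\in G_k}\sigma(y)$. Write $0\le i<m$ as $i=\sum_{k=0}^{r-1} i_k\,p_1\cdots p_k$ with $0\le i_k<p_{k+1}$, put $\mathbf y^{\mathbf i}=\prod_{k=0}^{r-1}y_k^{i_k}$ and $d=-\nu_{P_\infty}(y)$, and let $$\mathcal B=\{\mathbf y^{\mathbf i}t_j:\ 0\le i<m,\ j\in H(Q_\infty),\ id+jm\le\lambda\}.$$ **Algorithm 1.** The input is $f$, given by its coefficients with respect to $\mathcal B$. For $j=1,\dots,r$, a function $f$ on level $j-1$ is written $f=\sum_{k<p_j}f_{j,k}\,y_{j-1}^k$ by grouping its coefficients according to the digit $i_{j-1}$. The $f_{j,k}$ are evaluated at $\mathcal P^{(j)}=\mathcal P\cap E_j$: recursively if $j<r$, and by a given algorithm for the multipoint evaluation (MPE) at $\mathcal Q$ if $j=r$. Then $f(P)=\sum_k f_{j,k}(P\cap E_j)\,y_{j-1}(P)^k$ is computed for all $P\in\mathcal P^{(j-1)}$ by Horner's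 rule. (If $m=1$, the given algorithm is called directly.) Algorithms are straight-line programs over $\mathbb F_q$; their time is the number of operations $+,-,\cdot,/$ in $\mathbb F_q$, and constants depending only on the codes are precomputed. **Theorem.** One has $N=ms$, and chains of subgroups as above exist. For every constant $C>0$ there is a constant $C'>0$, depending only on $C$, such that in every situation as above and for every choice of the chain and of the $t_j$ the following holds. If the given algorithm solves the MPE for $C(\mathcal Q,\lfloor\lambda/m\rfloor Q_\infty)$, that is, it computes $\mathrm{ev}_{\mathcal Q}(g)$ from the coefficients of $g\in\mathcal L(\lfloor\lambda/m\rfloor Q_\infty)$ with respect to $\{t_j: j\in H(Q_\infty),\ j\le\lfloor\lambda/m\rfloor\}$, in time at most $C\cdot B\,s\log s$, then $\mathcal B$ is an $\mathbb F_q$-basis of $\mathcal L(\lambda P_\infty)$, and Algorithm 1 computes $\mathrm{ev}_{\mathcal P}(f)$ for all $f\in\mathcal L(\lambda P_\infty)$, i.e. it encodes $C(\mathcal P,\lambda P_\infty)$, in time at most $C'\cdot B\,N\log N$. -/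

import Mathlib

universe u

/-! ### Arithmetic circuits over a field -/

/-- Straight-line arithmetic programs over `K` whose inputs are labelled by `ι` and whose outputs are
labelled by `o`.  Copying, permuting, discarding values and loading fixed constants (`wire`) is free
of charge; each of the other basic operations is a componentwise field operation on two vectors
indexed by the finite type `o`.  A value computed once can be used arbitrarily often (`seq`). -/
inductive Circuit (K : Type u) : Type u → Type u → Type (u + 1)
  | wire {ι o : Type u} (f : o → ι ⊕ K) : Circuit K ι o
  | add {ι o : Type u} [Finite o] (c d : Circuit K ι o) : Circuit K ι o
  | sub {ι o : Type u} [Finite o] (c d : Circuit K ι o) : Circuit K ι o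
  | mul {ι o : Type u} [Finite o] (c d : Circuit K ι o) : Circuit K ι o
  | div {ι o : Type u} [Finite o] (c d : Circuit K ι o) : Circuit K ι o
  | pair {ι a b : Type u} (c : Circuit K ι a) (d : Circuit K ι b) : Circuit K ι (a ⊕ b)
  | seq {ι a o : Type u} (c : Circuit K ι a) (d : Circuit K a o) : Circuit K ι o

namespace Circuit

/-- The function computed by a circuit. -/
def eval {K : Type u} [Field K] : {ι o : Type u} → Circuit K ι o → (ι → K) → o → K
  | _, _, wire f, x => fun w => Sum.elim x id (f w)
  | _, _, add c d, x => fun w => c.eval x w + d.eval x w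
  | _, _, sub c d, x => fun w => c.eval x w - d.eval x w
  | _, _, mul c d, x => fun w => c.eval x w * d.eval x w
  | _, _, div c d, x => fun w => c.eval x w / d.eval x w
  | _, _, pair c d, x => Sum.elim (c.eval x) (d.eval x)
  | _, _, seq c d, x => d.eval (c.eval x)

/-- The number of operations `+`, `-`, `*`, `/` in `K` that a circuit performs. -/
noncomputable def cost {K : Type u} : {ι o : Type u} → Circuit K ι o → ℕ
  | _, _, wire _ => 0
  | _, o, add c d => c.cost + d.cost + Nat.card o
  | _, o, sub c d => c.cost + d.cost + Nat.card o
  | _, o, mul c d => c.cost + d.cost + Nat.card o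
  | _, o, div c d => c.cost + d.cost + Nat.card o
  | _, _, pair c d => c.cost + d.cost
  | _, _, seq c d => c.cost + d.cost

/-- Pure relabelling of values. -/
def select {K ι o : Type u} (f : o → ι) : Circuit K ι o := wire fun w => Sum.inl (f w)

/-- Loading constants. -/
def const {K ι o : Type u} (a : o → K) : Circuit K ι o := wire fun w => Sum.inr (a w)

/-- Horner's rule: from circuits computing the vectors `v₀, v₁, …`, a circuit computing the vector
`v₀ + v₁ η + v₂ η² + ⋯` (componentwise in `o`) for a fixed vector `η`. -/
def horner {K ι o : Type u} [Field K] [Finite o] (η : o → K) :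
    List (Circuit K ι o) → Circuit K ι o
  | [] => const 0
  | c :: cs => add c (mul (const η) (horner η cs))

end Circuit

/-- The recursive evaluation scheme, for abstract data.  There are levels `0, …, r`; level `j` has the
finite set of points `X j`, the points of level `j` restrict to points of level `j + 1` via `π j`,
and `η j x` is the value of the `j`-th generator at the point `x ∈ X j`.  A function of level `0` is
given by its coefficients with respect to products `(∏ k, y_k ^ i_k) * t`, where `0 ≤ i_k < p k` and
`t` ranges over a family labelled by `J`.  The coefficients with first digit `k` are those of `f_k` in
`f = f₀ + f₁ y₀ + ⋯ + f_{p-1} y₀^(p-1)`, `p = p 0`; the `f_k` are functions of level `1` and are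
evaluated recursively on `X 1`; afterwards `f` is evaluated at each point of `X 0` from the values
of the `f_k` at its restriction.  On the last level the given circuit `A` is called. -/
def fmpe {K J : Type u} [Field K] :
    (r : ℕ) → (p : ℕ → ℕ) → (X : ℕ → Type u) → (∀ j, Finite (X j)) →
      (∀ j, X j → X (j + 1)) → (∀ j, X j → K) → Circuit K J (X r) →
        Circuit K ((∀ k : Fin r, Fin (p k)) × J) (X 0)
  | 0, _, _, _, _, _, A => (Circuit.select fun j => (fun k => k.elim0, j)).seq A
  | r + 1, p, X, hX, π, η, A =>
    haveI := hX 0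
    Circuit.horner (η 0) (List.ofFn fun k : Fin (p 0) =>
      ((Circuit.select fun ij => (Fin.cons (α := fun l : Fin (r + 1) => Fin (p l)) k ij.1, ij.2)).seq
        (fmpe r (fun j => p (j + 1)) (fun j => X (j + 1)) (fun j => hX (j + 1))
          (fun j => π (j + 1)) (fun j => η (j + 1)) A)).seq
      (Circuit.select (π 0)))

/-! ### Function fields, places, Riemann-Roch spaces -/

/-- `F` is a function field of one variable over `K`. -/
def IsFunctionField (K F : Type u) [Field K] [Field F] [Algebra K F] : Prop :=
  ∃ x : F, Transcendental K x ∧ FiniteDimensional (IntermediateField.adjoin K {x}) F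

/-- `K` is algebraically closed in `F`. -/
def IsFullConstantField (K F : Type u) [Field K] [Field F] [Algebra K F] : Prop :=
  ∀ z : F, IsAlgebraic K z → z ∈ Set.range (algebraMap K F)

/-- A place of `F / K`, given by its valuation ring: a discrete valuation ring with fraction field `F`
containing `K`. -/
structure Place (K F : Type u) [Field K] [Field F] [Algebra K F] where
  valRing : ValuationSubring F
  algebraMap_mem : ∀ a : K, algebraMap K F a ∈ valRing
  isDVR : IsDiscreteValuationRing valRing

/-- The residue class in `K` of an element `z` of a local ring `O ⊆ E` containing `K`: the element
`a` of `K` such that `z - a` is in the maximal ideal of `O` (for a residue field equal to `K`). -/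
noncomputable def residueValue (K : Type u) {E : Type u} [Field K] [Field E] [Algebra K E]
    (O : Subring E) (z : E) : K :=
  Classical.epsilon fun a : K => ∃ w ∈ nonunits O, (w : E) = z - algebraMap K E a

namespace Place

section

variable {K F : Type u} [Field K] [Field F] [Algebra K F]

/-- The multiplicative form `exp (-ν_P)` of the normalized discrete valuation of a place. -/
noncomputable def val (P : Place K F) : Valuation F (WithZero (Multiplicative ℤ)) :=
  haveI := P.isDVR
  (IsDiscreteValuationRing.maximalIdeal P.valRing).valuation F

/-- `ν_P(z)` for `z ≠ 0` (by convention `0` at `z = 0`). -/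
noncomputable def ord (P : Place K F) (z : F) : ℤ := -WithZero.log (P.val z)

/-- The residue field of `P` is `K`. -/
def IsRational (P : Place K F) : Prop :=
  ∀ z ∈ P.valRing, ∃ a : K, P.val (z - algebraMap K F a) < 1

/-- `f(P)`, for a rational place `P` and `f` regular at `P`. -/
noncomputable def value (P : Place K F) (f : F) : K := residueValue K P.valRing.toSubring f

/-- The Riemann-Roch space `L(D) = {z | ν_P(z) + D(P) ≥ 0 for all P} ∪ {0}`. -/
noncomputable def riemannRoch (D : Place K F →₀ ℤ) : Submodule K F where
  carrier := {z | z = 0 ∨ ∀ P : Place K F, 0 ≤ P.ord z + D P}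
  zero_mem' := Or.inl rfl
  add_mem' := by
    intro a b ha hb
    by_cases ha0 : a = 0
    · simpa [ha0] using hb
    by_cases hb0 : b = 0
    · simpa [hb0] using ha
    by_cases hab : a + b = 0
    · exact Or.inl hab
    refine Or.inr fun P => ?_
    have h1 := (ha.resolve_left ha0) P
    have h2 := (hb.resolve_left hb0) P
    have hva := (map_ne_zero P.val).2 ha0
    have hvb := (map_ne_zero P.val).2 hb0
    have hvab := (map_ne_zero P.val).2 hab
    simp only [ord] at h1 h2 ⊢
    rcases le_max_iff.1 (P.val.map_add a b) with h | h
    · have := (WithZero.log_le_log hvab hva).2 h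
      omega
    · have := (WithZero.log_le_log hvab hvb).2 h
      omega
  smul_mem' := by
    intro c a ha
    by_cases hc : c = 0
    · exact Or.inl (by simp [hc])
    rcases ha with ha | ha
    · exact Or.inl (by simp [ha])
    refine Or.inr fun P => ?_
    have hcF : algebraMap K F c ≠ 0 := by simpa using hc
    have key : ∀ e : K, P.val (algebraMap K F e) ≤ 1 := by
      intro e
      have := P.isDVR
      exact (IsDiscreteValuationRing.maximalIdeal P.valRing).valuation_le_one
        (K := F) (⟨algebraMap K F e, P.algebraMap_mem e⟩ : P.valRing)
    have hval : P.val (algebraMap K F c) = 1 := by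
      refine le_antisymm (key c) ?_
      have h := key c⁻¹
      rw [map_inv₀, map_inv₀] at h
      exact (inv_le_one₀ (zero_lt_iff.2 ((map_ne_zero P.val).2 hcF))).1 h
    have h := ha P
    simp only [ord] at h ⊢
    rw [Algebra.smul_def, map_mul, hval, one_mul]
    exact h

/-- The algebraic geometry code `C(𝓟, D)`. -/
def agCode (𝓟 : Finset (Place K F)) (D : Place K F →₀ ℤ) : Set (𝓟 → K) :=
  {v | ∃ f ∈ riemannRoch D, v = fun P => P.1.value f}

/-- The pole divisor of `z` is `j Q`. -/
def HasPoleDivisor (Q : Place K F) (z : F) (j : ℕ) : Prop :=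
  z ≠ 0 ∧ ∀ P : Place K F, max 0 (-P.ord z) = Finsupp.single Q (j : ℤ) P

/-- The Weierstrass semigroup `H(Q)`. -/
def weierstrassSemigroup (Q : Place K F) : Set ℕ := {j | ∃ z : F, Q.HasPoleDivisor z j}

end

section

variable {K F E : Type u} [Field K] [Field F] [Field E] [Algebra K F] [Algebra F E] [Algebra K E]

/-- The place `P` of `E` lies over the place `Q` of `F`. -/
def LiesOver (P : Place K E) (Q : Place K F) : Prop :=
  P.valRing.comap (algebraMap F E) = Q.valRing

/-- The ramification index `e(P|Q)` is `e`. -/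
def HasRamificationIndex (P : Place K E) (Q : Place K F) (e : ℕ) : Prop :=
  ∀ z : F, P.val (algebraMap F E z) = Q.val z ^ e

/-- The relative degree `f(P|Q)` is `1`: the residue field of `P` is that of `Q`. -/
def HasRelativeDegreeOne (P : Place K E) (Q : Place K F) : Prop :=
  ∀ z ∈ P.valRing, ∃ w ∈ Q.valRing, P.val (z - algebraMap F E w) < 1

/-- `Q` splits completely in `E / F`. -/
def SplitsCompletely (E : Type u) [Field E] [Algebra F E] [Algebra K E] (Q : Place K F) : Prop :=
  {P : Place K E | P.LiesOver Q}.ncard = Module.finrank F E ∧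
    ∀ P : Place K E, P.LiesOver Q → P.HasRamificationIndex Q 1 ∧ P.HasRelativeDegreeOne Q

/-- `P` lies over `Q` and is totally ramified in `E / F`. -/
def IsTotallyRamified (P : Place K E) (Q : Place K F) : Prop :=
  P.LiesOver Q ∧ (∀ P' : Place K E, P'.LiesOver Q → P' = P) ∧
    P.HasRamificationIndex Q (Module.finrank F E) ∧ P.HasRelativeDegreeOne Q

/-- `w ∈ E` is in the integral closure of the valuation ring of `Q` in `E`. -/
def IsIntegralAt (Q : Place K F) (w : E) : Prop :=
  ((algebraMap F E).comp Q.valRing.subtype).IsIntegralElem w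

/-- The family `z` is an integral basis of `E / F` at `Q`: a basis of the integral closure in `E` of
the valuation ring of `Q` as a module over this ring. -/
def IsIntegralBasisAt (Q : Place K F) {n : ℕ} (z : Fin n → E) : Prop :=
  (∀ i, Q.IsIntegralAt (z i)) ∧
    ∀ w : E, Q.IsIntegralAt w →
      ∃! c : Fin n → Q.valRing, w = ∑ i, algebraMap F E (c i : F) * z i

end

end Place

/-- The four properties of `E = F(y)`, with `P∞` lying over `Q∞`. -/
structure FourProperties {K F E : Type u} [Field K] [Field F] [Field E] [Algebra K F]
    [Algebra F E] [Algebra K E] (y : E) (Pinf : Place K E) (Qinf : Place K F) : Prop where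
  isAbelian : IsAbelianGalois F E
  adjoin_eq_top : IntermediateField.adjoin F {y} = ⊤
  conj_affine : ∀ σ : E ≃ₐ[F] E, ∃ a b : K, a ≠ 0 ∧ σ y = algebraMap K E a * y + algebraMap K E b
  isRational : Pinf.IsRational
  isTotallyRamified : Pinf.IsTotallyRamified Qinf
  gcd_eq_one : Int.gcd (Module.finrank F E) (Pinf.ord y) = 1
  isIntegralBasisAt : ∀ Q : Place K F, Q ≠ Qinf →
    Q.IsIntegralBasisAt fun i : Fin (Module.finrank F E) => y ^ (i : ℕ)

/-! ### Multipoint evaluation -/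

section

variable {K L : Type u} [Field K] [Field L] [Algebra K L]

/-- The circuit `A` solves the multipoint evaluation problem at the points `𝓟` for the functions
`∑ a_i f_i`, the input being the coefficients `a_i`. -/
def ComputesMPE {ι : Type u} (f : ι → L) (𝓟 : Finset (Place K L)) (A : Circuit K ι 𝓟) : Prop :=
  ∀ (a : ι →₀ K) (P : 𝓟), A.eval a P = P.1.value (Finsupp.linearCombination K f a)

/-- The circuit `A` is an encoder for `C(𝓟, D)` with respect to the basis `f` of `L(D)`: it maps a
message `a` to the codeword `ev_𝓟 (∑ a_i f_i)`. -/
structure Encodes {ι : Type u} (f : ι → L) (𝓟 : Finset (Place K L)) (D : Place K L →₀ ℤ)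
    (A : Circuit K ι 𝓟) : Prop where
  linearIndependent : LinearIndependent K f
  span_eq : Submodule.span K (Set.range f) = Place.riemannRoch D
  computes : ComputesMPE f 𝓟 A
  range_eq : Set.range (fun a : ι →₀ K => A.eval a) = Place.agCode 𝓟 D

/-- The pole numbers `j ≤ n` of `Q`. -/
abbrev PoleIndex (Q : Place K L) (n : ℕ) : Type u :=
  {j : ULift.{u} ℕ // j.down ∈ Q.weierstrassSemigroup ∧ j.down ≤ n}

end

/-! ### The tower, the basis, and the divide-and-conquer algorithm -/

section

variable {K F E : Type u} [Field K] [Field F] [Field E] [Algebra K F] [Algebra F E] [Algebra K E]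

/-- A chain `1 = G 0 ≤ G 1 ≤ ⋯ ≤ G r = Gal(E/F)` with `[G (k + 1) : G k] = p k`. -/
structure IsGaloisChain (r : ℕ) (p : ℕ → ℕ) (G : ℕ → Subgroup (E ≃ₐ[F] E)) : Prop where
  zero : G 0 = ⊥
  last : G r = ⊤
  mono : Monotone G
  relIndex : ∀ k < r, (G k).relIndex (G (k + 1)) = p k

/-- `y_k = ∏_{σ ∈ G k} σ(y)`. -/
noncomputable def towerGen (G : ℕ → Subgroup (E ≃ₐ[F] E)) (y : E) (k : ℕ) : E :=
  ∏ᶠ σ : G k, (σ : E ≃ₐ[F] E) y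

/-- The integer `i = i₀ + i₁ p₀ + i₂ p₀ p₁ + ⋯` with digits `i_k < p k`. -/
def digitSum {r : ℕ} {p : ℕ → ℕ} (i : ∀ k : Fin r, Fin (p k)) : ℕ :=
  ∑ k : Fin r, (i k : ℕ) * ∏ l ∈ Finset.range k, p l

/-- The labels `(i, j)`, `0 ≤ i < m`, `j ∈ H(Q∞)`, `i d + j m ≤ lam` of the basis functions, the
number `i` being given by its digits. -/
abbrev BasisIndex (r : ℕ) (p : ℕ → ℕ) (Qinf : Place K F) (d : ℤ) (m lam : ℕ) : Type u :=
  {b : (∀ k : Fin r, Fin (p k)) × ULift.{u} ℕ //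
    b.2.down ∈ Qinf.weierstrassSemigroup ∧
      (digitSum b.1 : ℤ) * d + (b.2.down : ℤ) * m ≤ lam}

/-- The basis function `y_{r-1}^{i_{r-1}} ⋯ y_0^{i_0} t_j`. -/
noncomputable def basisFun {r : ℕ} {p : ℕ → ℕ} {Qinf : Place K F} {d : ℤ} {m lam : ℕ}
    (G : ℕ → Subgroup (E ≃ₐ[F] E)) (y : E) (t : ℕ → F) (b : BasisIndex r p Qinf d m lam) : E :=
  (∏ k : Fin r, towerGen G y k ^ (b.1.1 k : ℕ)) * algebraMap F E (t b.1.2.down)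

/-- The valuation ring (as a subring of `E`) of the place `P ∩ M` of the intermediate field `M`. -/
def Place.under (P : Place K E) (M : IntermediateField F E) : Subring E :=
  P.valRing.toSubring ⊓ M.toSubfield.toSubring

/-- The set `𝓟 ∩ M` of places of the intermediate field `M`, given by their valuation rings. -/
def placesUnder (𝓟 : Finset (Place K E)) (M : IntermediateField F E) : Set (Subring E) :=
  (fun P => P.under M) '' (𝓟 : Set (Place K E))

theorem placesUnder_finite (𝓟 : Finset (Place K E)) (M : IntermediateField F E) :
    Finite (placesUnder 𝓟 M) :=
  (𝓟.finite_toSet.image _).to_subtype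

/-- The restriction map `𝓟 ∩ M → 𝓟 ∩ M'` for `M' ≤ M`. -/
def placesUnder.restrict {𝓟 : Finset (Place K E)} {M M' : IntermediateField F E} (h : M' ≤ M)
    (O : placesUnder 𝓟 M) : placesUnder 𝓟 M' :=
  ⟨O.1 ⊓ M'.toSubfield.toSubring, by
    obtain ⟨_, P, hP, rfl⟩ := O
    refine ⟨P, hP, ?_⟩
    have h' : M'.toSubfield.toSubring ≤ M.toSubfield.toSubring := h
    simp only [Place.under]
    rw [inf_assoc, inf_eq_right.2 h']⟩

theorem placesUnder.exists_base {𝓟 : Finset (Place K E)} {𝓠 : Finset (Place K F)}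
    (h𝓟 : ∀ P, P ∈ 𝓟 ↔ ∃ Q ∈ 𝓠, P.LiesOver Q) {M : IntermediateField F E}
    (O : placesUnder 𝓟 M) :
    ∃ Q : 𝓠, Q.1.valRing.toSubring = O.1.comap (algebraMap F E) := by
  obtain ⟨_, P, hP, rfl⟩ := O
  obtain ⟨Q, hQ, hPQ⟩ := (h𝓟 P).1 hP
  refine ⟨⟨Q, hQ⟩, ?_⟩
  ext z
  have : z ∈ Q.valRing ↔ algebraMap F E z ∈ P.valRing := by rw [← hPQ]; rfl
  simp only [ValuationSubring.mem_toSubring, this]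
  exact ⟨fun hz => ⟨hz, M.algebraMap_mem z⟩, fun hz => hz.1⟩

/-- The place of `𝓠` under a place of `𝓟 ∩ M`. -/
noncomputable def placesUnder.base {𝓟 : Finset (Place K E)} {𝓠 : Finset (Place K F)}
    (h𝓟 : ∀ P, P ∈ 𝓟 ↔ ∃ Q ∈ 𝓠, P.LiesOver Q) {M : IntermediateField F E}
    (O : placesUnder 𝓟 M) : 𝓠 :=
  Classical.choose (placesUnder.exists_base h𝓟 O)

open Classical in
/-- The divide-and-conquer algorithm for the tower `E_k = E^{G k}`, with point sets `𝓟 ∩ E_k` and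
generators `y_k`, calling the circuit `A` for the evaluations at `𝓠`.  Its input consists of the
coefficients of a function with respect to `basisFun`; the absent coefficients are `0`. -/
noncomputable def divideAndConquer {𝓟 : Finset (Place K E)} {𝓠 : Finset (Place K F)}
    (h𝓟 : ∀ P, P ∈ 𝓟 ↔ ∃ Q ∈ 𝓠, P.LiesOver Q) {r : ℕ} {p : ℕ → ℕ}
    {G : ℕ → Subgroup (E ≃ₐ[F] E)} (hG : IsGaloisChain r p G) (y : E) (Qinf : Place K F)
    (d : ℤ) (m lam : ℕ) (A : Circuit K (PoleIndex Qinf (lam / m)) 𝓠) :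
    Circuit K (BasisIndex r p Qinf d m lam) 𝓟 :=
  let M : ℕ → IntermediateField F E := fun k => IntermediateField.fixedField (G k)
  ((Circuit.wire fun b : (∀ k : Fin r, Fin (p k)) × PoleIndex Qinf (lam / m) =>
      if h : (digitSum b.1 : ℤ) * d + (b.2.1.down : ℤ) * m ≤ lam
        then Sum.inl ⟨(b.1, b.2.1), b.2.2.1, h⟩ else Sum.inr 0).seq
    (fmpe r p (fun k => placesUnder 𝓟 (M k)) (fun k => placesUnder_finite 𝓟 (M k))
      (fun k => placesUnder.restrict
        (IntermediateField.fixedField_antitone (hG.mono (Nat.le_succ k))))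
      (fun k O => residueValue K O.1 (towerGen G y k))
      (A.seq (Circuit.select (placesUnder.base h𝓟))))).seq
    (Circuit.select fun P => ⟨P.1.under (M 0), P.1, P.2, rfl⟩)

end

/-! Everything about the basis is read off from the valuation at $P_\infty$. Total ramification puts
the values of $F^*$ into $m\mathbb Z$, and $\gcd(m,\nu_{P_\infty}(y))=1$, so nonzero terms $c_iy^i$
with $c_i\in F$ and $0\le i<m$ have pairwise distinct values. Expand $f\in\mathcal L(\lambda
P_\infty)$ in powers of $y$. The integral bases make all $c_i$ regular outside $Q_\infty$, and the
pole order of $f$ is that of a single term, i.e. $id+jm$ with $j\in H(Q_\infty)$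
(`FourProperties.exists_ord_eq`). Since $y$ has a pole at $P_\infty$ when $m>1$, the conjugates
$ay+b$ have the same pole order as $y$. Hence $y_k$ has pole order $|G_k|d$ and $\mathbf y^{\mathbf
i}t_j$ has pole order $id+jm$ (`ord_basisFun`). So $\mathcal B$ contains exactly one function for
each possible pole order up to $\lambda$. Distinct orders give independence. As $P_\infty$ is
rational, subtracting a multiple of a basis function lowers the pole order, which gives spanning
(`mem_span_basisFun`).

Correctness of the algorithm: evaluation at a rational place is a ring homomorphism on its valuation
ring, and $y_k\in E_k$ has the same residue at $P\cap E_k$ as at $P$. Applied to $f=\sum_i\mathbf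
y^{\mathbf i}g_i$ with $g_i\in F$ it yields the sum computed by nested Horner schemes (`eval_fmpe`,
`computesMPE_divideAndConquer`).

Cost: level $j$ is entered $|G_j|$ times, each time with $2p_j$ operations per point of $\mathcal
P\cap E_j$. By complete splitting $G_j$ acts freely on $\mathcal P$, and its orbits restrict to
single points, so $|G_j|\,|\mathcal P\cap E_j|\le N$ (`card_placesUnder_mul_le`). A level thus costs
at most $2BN$, there are $r\le\log_2m$ levels, and the $m$ calls of the given algorithm cost at most
$C\,BN\log s$.

The facts on places used here (zeros of nonconstant functions, extension and restriction,
transitivity of the Galois action) are derived from valuation rings. Discreteness always comes from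
bounding, by the degree, the number of elements with values independent modulo the base field. -/

namespace Circuit

/-! ### Values and costs of the circuits -/

theorem eval_select {K ι o : Type u} [Field K] (f : o → ι) (x : ι → K) :
    (select f : Circuit K ι o).eval x = x ∘ f := rfl

theorem cost_select {K ι o : Type u} (f : o → ι) : (select f : Circuit K ι o).cost = 0 := rfl

theorem eval_horner {K ι o : Type u} [Field K] [Finite o] (η : o → K) (x : ι → K) (w : o) :
    ∀ {n : ℕ} (c : Fin n → Circuit K ι o),
      (horner η (List.ofFn c)).eval x w = ∑ k : Fin n, η w ^ (k : ℕ) * (c k).eval x w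
  | 0, c => by simp [horner, const, eval]
  | n + 1, c => by
    rw [List.ofFn_succ, Fin.sum_univ_succ]
    simp only [horner, eval, const, eval_horner, Sum.elim_inr, id, Finset.mul_sum]
    simp [pow_succ, mul_left_comm, mul_assoc]

/-- Each coefficient costs one multiplication and one addition per point; the count is exact because
the innermost step also multiplies by $\eta$, applied to the zero vector. -/
theorem cost_horner {K ι o : Type u} [Field K] [Finite o] (η : o → K) :
    ∀ {n : ℕ} (c : Fin n → Circuit K ι o),
      (horner η (List.ofFn c)).cost = ∑ k, (c k).cost + 2 * n * Nat.card o
  | 0, c => by simp [horner, const, cost]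
  | n + 1, c => by
    rw [List.ofFn_succ, Fin.sum_univ_succ]
    simp only [horner, cost, const, cost_horner]
    ring

end Circuit

/-- Evaluation along the tower: each output is the sum over the multi-indices of the products of the
generator values and of the output of the innermost circuit. -/
theorem eval_fmpe {K J S : Type u} [Field K] :
    ∀ (r : ℕ) (p : ℕ → ℕ) (X : ℕ → Type u) (hX : ∀ j, Finite (X j)) (π : ∀ j, X j → X (j + 1))
      (η : ∀ j, X j → K) (A : Circuit K J (X r)) (ρ : ∀ j, S → X j)
      (_ : ∀ j s, π j (ρ j s) = ρ (j + 1) s) (c : (∀ k : Fin r, Fin (p k)) × J → K) (s : S),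
      (fmpe r p X hX π η A).eval c (ρ 0 s) =
        ∑ i : ∀ k : Fin r, Fin (p k),
          (∏ k : Fin r, η k (ρ k s) ^ (i k : ℕ)) * A.eval (fun j => c (i, j)) (ρ r s)
  | 0, p, X, hX, π, η, A, ρ, hρ, c, s => by
    simp only [fmpe, Circuit.eval, Circuit.eval_select, Finset.univ_unique, Finset.sum_singleton,
      Finset.univ_eq_empty, Finset.prod_empty, one_mul]
    congr 1
  | r + 1, p, X, hX, π, η, A, ρ, hρ, c, s => by
    have := hX 0
    rw [fmpe, Circuit.eval_horner,
      ← (Fin.consEquiv fun l : Fin (r + 1) => Fin (p l)).sum_comp, Fintype.sum_prod_type]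
    refine Finset.sum_congr rfl fun k _ => ?_
    have := eval_fmpe r (fun j => p (j + 1)) (fun j => X (j + 1)) (fun j => hX (j + 1))
          (fun j => π (j + 1)) (fun j => η (j + 1)) A (fun j => ρ (j + 1))
          (fun j => hρ (j + 1))
          (fun ij => c (Fin.cons (α := fun l : Fin (r + 1) => Fin (p l)) k ij.1, ij.2)) s
    simp only [Circuit.eval, Circuit.eval_select, Function.comp_apply, hρ]
    erw [this]
    rw [Finset.mul_sum]
    refine Finset.sum_congr rfl fun i _ => ?_
    rw [Fin.prod_univ_succ, mul_assoc]
    rfl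

/-- Level $j$ is entered once for every choice of the first $j$ digits, and the innermost circuit
once for every full multi-index. -/
theorem cost_fmpe {K J : Type u} [Field K] :
    ∀ (r : ℕ) (p : ℕ → ℕ) (X : ℕ → Type u) (hX : ∀ j, Finite (X j)) (π : ∀ j, X j → X (j + 1))
      (η : ∀ j, X j → K) (A : Circuit K J (X r)),
      (fmpe r p X hX π η A).cost = (∏ k ∈ Finset.range r, p k) * A.cost +
        ∑ j ∈ Finset.range r, (∏ k ∈ Finset.range j, p k) * (2 * p j * Nat.card (X j))
  | 0, p, X, hX, π, η, A => by simp [fmpe, Circuit.cost, Circuit.cost_select]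
  | r + 1, p, X, hX, π, η, A => by
    have := hX 0
    rw [fmpe, Circuit.cost_horner]
    simp only [Circuit.cost, Circuit.cost_select]
    have := cost_fmpe r (fun j => p (j + 1)) (fun j => X (j + 1)) (fun j => hX (j + 1))
          (fun j => π (j + 1)) (fun j => η (j + 1)) A
    erw [this]
    rw [Finset.sum_range_succ', Finset.prod_range_succ']
    simp only [zero_add, add_zero, Finset.sum_const, Finset.card_univ, Fintype.card_fin,
      smul_eq_mul, Finset.prod_range_succ', Finset.range_zero, Finset.prod_empty, one_mul, mul_add,
      Finset.mul_sum]
    rw [add_assoc]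
    congr 1
    · ring
    · congr 1
      exact Finset.sum_congr rfl fun _ _ => by ring

/-! ### Orders, residues and Riemann–Roch spaces -/

namespace Place

variable {K F : Type u} [Field K] [Field F] [Algebra K F] (P : Place K F)

theorem val_le_one_iff {z : F} : P.val z ≤ 1 ↔ z ∈ P.valRing := by
  have := P.isDVR
  constructor
  · intro h
    obtain ⟨a, rfl⟩ := IsDiscreteValuationRing.exists_lift_of_le_one (A := P.valRing) h
    exact a.2
  · intro h
    exact (IsDiscreteValuationRing.maximalIdeal P.valRing).valuation_le_one
        (K := F) (⟨z, h⟩ : P.valRing)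

/-- Two valuations with the same ring of integers have, on passing to inverses, the same maximal
ideal. This is the bridge between `P.val` and the canonical valuation of `P.valRing`. -/
theorem val_lt_one_iff {z : F} : P.val z < 1 ↔ P.valRing.valuation z < 1 := by
  by_cases hz : z = 0
  · simp [hz]
  rw [← not_le, ← not_le, not_iff_not, ← inv_le_one₀ (by simpa [zero_lt_iff] using hz), ← map_inv₀,
    ← inv_le_one₀ (by simpa [zero_lt_iff] using hz), ← map_inv₀, P.val_le_one_iff,
    ValuationSubring.valuation_le_one_iff]

theorem val_algebraMap {a : K} (ha : a ≠ 0) : P.val (algebraMap K F a) = 1 := by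
  refine le_antisymm (P.val_le_one_iff.2 (P.algebraMap_mem a)) ?_
  have h := P.val_le_one_iff.2 (P.algebraMap_mem a⁻¹)
  rw [map_inv₀, map_inv₀] at h
  exact (inv_le_one₀ (zero_lt_iff.2 (by simpa using ha))).1 h

theorem val_eq_exp {z : F} (hz : z ≠ 0) : P.val z = WithZero.exp (-P.ord z) := by
  rw [ord, neg_neg, WithZero.exp_log ((map_ne_zero _).2 hz)]

theorem ord_mul {z w : F} (hz : z ≠ 0) (hw : w ≠ 0) : P.ord (z * w) = P.ord z + P.ord w := by
  rw [ord, map_mul, WithZero.log_mul ((map_ne_zero _).2 hz) ((map_ne_zero _).2 hw), ord, ord]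
  ring

theorem ord_pow (z : F) (n : ℕ) : P.ord (z ^ n) = n * P.ord z := by
  rw [ord, map_pow, WithZero.log_pow, ord]
  simp

theorem ord_nonneg_iff {z : F} (hz : z ≠ 0) : 0 ≤ P.ord z ↔ z ∈ P.valRing := by
  rw [← val_le_one_iff, val_eq_exp P hz, ← WithZero.exp_zero, WithZero.exp_le_exp]
  omega

/-- The condition `hO'` makes every element of `O` that is a unit at $P$ a unit of `O`. It holds for
the full valuation ring and for its intersection with a subfield. -/
theorem coe_nonunits_iff {O : Subring F} {w : F} (hO : O ≤ P.valRing.toSubring)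
    (hO' : ∀ z ∈ O, z⁻¹ ∈ P.valRing → z⁻¹ ∈ O) :
    (∃ z ∈ nonunits O, (z : F) = w) ↔ w ∈ O ∧ P.val w < 1 := by
  constructor
  · rintro ⟨z, hz, rfl⟩
    refine ⟨z.2, lt_of_le_of_ne (P.val_le_one_iff.2 (hO z.2)) fun h => hz ?_⟩
    have hz0 : (z : F) ≠ 0 := by
      rintro h0
      simp [h0] at h
    have hinv : (z : F)⁻¹ ∈ O := hO' _ z.2 (P.val_le_one_iff.1 (by rw [map_inv₀, h, inv_one]))
    exact IsUnit.of_mul_eq_one ⟨_, hinv⟩ (Subtype.ext (mul_inv_cancel₀ hz0))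
  · rintro ⟨hw, hw1⟩
    refine ⟨⟨w, hw⟩, fun h => ?_, rfl⟩
    obtain ⟨v, hv⟩ := h.exists_right_inv
    have h1 : w * (v : F) = 1 := congrArg Subtype.val hv
    have h2 := P.val_le_one_iff.2 (hO v.2)
    have h3 : P.val w * P.val v = 1 := by rw [← map_mul, h1, map_one]
    exact absurd h3 (mul_lt_one_of_nonneg_of_lt_one_left zero_le hw1 h2).ne

/-- Two candidates for the residue would differ by a nonzero constant, which has value 1; so the
choice made by `Classical.epsilon` is forced. -/
theorem residueValue_eq {O : Subring F} (hO : O ≤ P.valRing.toSubring)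
    (hO' : ∀ z ∈ O, z⁻¹ ∈ P.valRing → z⁻¹ ∈ O) (hK : ∀ a : K, algebraMap K F a ∈ O)
    {z : F} (hz : z ∈ O) {a : K} (ha : P.val (z - algebraMap K F a) < 1) :
    residueValue K O z = a := by
  have key : ∀ b : K, (∃ w ∈ nonunits O, (w : F) = z - algebraMap K F b) ↔ b = a := by
    intro b
    rw [P.coe_nonunits_iff hO hO']
    refine ⟨fun h => ?_, ?_⟩
    · by_contra hba
      have h1 := P.val.map_sub_lt ha h.2
      rw [sub_sub_sub_cancel_left, ← map_sub, P.val_algebraMap (sub_ne_zero.2 hba)] at h1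
      exact lt_irrefl _ h1
    · rintro rfl
      exact ⟨sub_mem hz (hK _), ha⟩
  exact (key _).1 (Classical.epsilon_spec (p := fun b => ∃ w ∈ nonunits O,
    (w : F) = z - algebraMap K F b) ⟨a, (key a).2 rfl⟩)

theorem value_eq {z : F} {a : K} (ha : P.val (z - algebraMap K F a) < 1) : P.value z = a := by
  refine P.residueValue_eq le_rfl (fun _ _ h => h) P.algebraMap_mem ?_ ha
  have := add_mem (P.val_le_one_iff.1 ha.le) (P.algebraMap_mem a)
  rwa [sub_add_cancel] at this

theorem IsRational.val_sub_value {P : Place K F} (hP : P.IsRational) {z : F} (hz : z ∈ P.valRing) :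
    P.val (z - algebraMap K F (P.value z)) < 1 := by
  obtain ⟨a, ha⟩ := hP z hz
  rwa [P.value_eq ha]

/-- Evaluation at a rational place, on its valuation ring. -/
noncomputable def valueHom {P : Place K F} (hP : P.IsRational) : P.valRing →+* K where
  toFun z := P.value (z : F)
  map_zero' := P.value_eq (by simp)
  map_one' := P.value_eq (by simp)
  map_add' z w := P.value_eq (by
    have := P.val.map_add_lt (hP.val_sub_value z.2) (hP.val_sub_value w.2)
    rw [map_add]
    convert this using 2
    push_cast
    ring)
  map_mul' z w := P.value_eq (by
    -- $zw-ab=z(w-b)+b(z-a)$, where $a,b$ are the residues of $z,w$.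
    have h1 : P.val (z * (w - algebraMap K F (P.value w))) < 1 := by
      rw [map_mul]
      exact mul_lt_one_of_nonneg_of_lt_one_right (P.val_le_one_iff.2 z.2) zero_le
        (hP.val_sub_value w.2)
    have h2 : P.val (algebraMap K F (P.value w) * (z - algebraMap K F (P.value z))) < 1 := by
      rw [map_mul]
      exact mul_lt_one_of_nonneg_of_lt_one_right (P.val_le_one_iff.2 (P.algebraMap_mem _)) zero_le
        (hP.val_sub_value z.2)
    have := P.val.map_add_lt h1 h2
    rw [map_mul]
    convert this using 2
    push_cast
    ring)

theorem mem_riemannRoch_single {Q : Place K F} {n : ℕ} {z : F} :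
    z ∈ riemannRoch (Finsupp.single Q (n : ℤ)) ↔
      (∀ P ≠ Q, z ∈ P.valRing) ∧ Q.val z ≤ WithZero.exp (n : ℤ) := by
  change (z = 0 ∨ ∀ P : Place K F, 0 ≤ P.ord z + Finsupp.single Q (n : ℤ) P) ↔ _
  by_cases hz : z = 0
  · simp [hz]
  simp only [hz, false_or]
  rw [Q.val_eq_exp hz, WithZero.exp_le_exp]
  refine ⟨fun h => ⟨fun P hP => ?_, ?_⟩, fun h P => ?_⟩
  · have := h P
    rw [Finsupp.single_eq_of_ne hP, add_zero] at this
    exact (P.ord_nonneg_iff hz).1 this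
  · have := h Q
    rw [Finsupp.single_eq_same] at this
    omega
  · by_cases hP : P = Q
    · subst hP
      rw [Finsupp.single_eq_same]
      have := h.2
      omega
    · rw [Finsupp.single_eq_of_ne hP, add_zero]
      exact (P.ord_nonneg_iff hz).2 (h.1 P hP)

theorem mem_riemannRoch_single_iff_ord {Q : Place K F} {n : ℕ} {z : F} (hz : z ≠ 0) :
    z ∈ riemannRoch (Finsupp.single Q (n : ℤ)) ↔
      (∀ P ≠ Q, z ∈ P.valRing) ∧ -Q.ord z ≤ n := by
  rw [mem_riemannRoch_single, Q.val_eq_exp hz, WithZero.exp_le_exp]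

theorem ext_valRing {P Q : Place K F} (h : P.valRing = Q.valRing) : P = Q := by
  cases P; cases Q; cases h; rfl

end Place

/-! ### Terms of distinct value, and criteria for discreteness -/

namespace Valuation

variable {L Γ : Type*} [Field L] [LinearOrderedCommGroupWithZero Γ] (v : Valuation L Γ)

/-- If the terms of a sum have distinct values, then the value of the sum is the largest of them. -/
theorem exists_map_sum_eq {ι : Type*} {s : Finset ι} (hs : s.Nonempty) {f : ι → L}
    (hf : Set.InjOn (fun i => v (f i)) s) :
    ∃ i ∈ s, v (∑ j ∈ s, f j) = v (f i) ∧ ∀ j ∈ s, v (f j) ≤ v (f i) := by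
  classical
  obtain ⟨i, hi, hmax⟩ := s.exists_max_image (fun i => v (f i)) hs
  refine ⟨i, hi, v.map_sum_eq_of_lt hi fun j hj => ?_, hmax⟩
  rw [Finset.mem_sdiff, Finset.mem_singleton] at hj
  exact lt_of_le_of_ne (hmax j hj.1) fun h => hj.2 (hf hj.1 hi h)

/-- In a nontrivial relation the terms with nonzero coefficient have distinct values, so the sum 0
would have the value of a nonzero term. -/
theorem linearIndependent_of_ne {F : Type*} [Field F] [Algebra F L] {ι : Type*} {a : ι → L}
    (ha : ∀ i, a i ≠ 0)
    (h : ∀ i j, i ≠ j → ∀ c d : F, c ≠ 0 → d ≠ 0 →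
      v (algebraMap F L c * a i) ≠ v (algebraMap F L d * a j)) : LinearIndependent F a := by
  classical
  rw [linearIndependent_iff']
  intro s g hg
  by_contra! hne
  obtain ⟨i₀, hi₀, hgi₀⟩ := hne
  have hsum : ∑ i ∈ s with g i ≠ 0, g i • a i = 0 := by
    rw [← hg]
    exact Finset.sum_filter_of_ne fun i _ h0 h1 => h0 (by rw [h1, zero_smul])
  obtain ⟨i, hi, hv, -⟩ := v.exists_map_sum_eq (s := {i ∈ s | g i ≠ 0}) (f := fun i => g i • a i)
    ⟨i₀, by simp [hi₀, hgi₀]⟩ (by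
      intro i hi j hj hij
      by_contra hne
      simp only [Finset.coe_filter, Set.mem_ofPred_eq] at hi hj
      simp only [Algebra.smul_def] at hij
      exact h i j hne _ _ hi.2 hj.2 hij)
  rw [hsum, map_zero, Algebra.smul_def, eq_comm, map_eq_zero, mul_eq_zero, map_eq_zero] at hv
  exact hv.elim (Finset.mem_filter.1 hi).2 (ha i)

end Valuation

namespace ValuationSubring

variable {L : Type*} [Field L]

/-- A criterion for a valuation ring to be discrete: there are finitely many values between that of
some nonunit `w` and `1`, and the powers of the value of `w` are cofinal. -/
theorem isDiscreteValuationRing_of_finite (V : ValuationSubring L) {w : L} (hw0 : w ≠ 0)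
    (hw : V.valuation w < 1)
    (hfin : {g | V.valuation w < g ∧ g ≤ 1}.Finite)
    (harch : ∀ f : L, f ≠ 0 → ∃ k : ℕ, V.valuation w ^ k ≤ V.valuation f) :
    IsDiscreteValuationRing V := by
  -- The element $\pi$ has the largest value below 1, which exists because only finitely many values
  -- lie between that of $w$ and 1.
  obtain ⟨π, hπ1, hπmax⟩ : ∃ π : L, V.valuation π < 1 ∧ ∀ f, V.valuation f < 1 →
      V.valuation f ≤ V.valuation π := by
    have hfin' : {g | V.valuation w ≤ g ∧ g < 1}.Finite := by
      refine (hfin.insert (V.valuation w)).subset fun g hg => ?_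
      rcases hg.1.eq_or_lt with h | h
      · exact Or.inl h.symm
      · exact Or.inr ⟨h, hg.2.le⟩
    obtain ⟨g, hg, hmax⟩ := hfin'.exists_maximalFor id _ ⟨_, le_rfl, hw⟩
    obtain ⟨π, rfl⟩ := V.valuation_surjective g
    refine ⟨π, hg.2, fun f hf => ?_⟩
    rcases le_total (V.valuation f) (V.valuation π) with h | h
    · exact h
    · exact hmax ⟨hg.1.trans h, hf⟩ h
  have hπ0 : 0 < V.valuation π := lt_of_lt_of_le (by simpa [zero_lt_iff] using hw0) (hπmax w hw)
  have hanti : StrictAnti fun n : ℕ => V.valuation π ^ n := pow_right_strictAnti₀ hπ0 hπ1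
  -- Otherwise the strictly decreasing powers of the value of $\pi$ would be infinitely many values
  -- in the finite set of `hfin`.
  obtain ⟨n, hn⟩ : ∃ n : ℕ, V.valuation π ^ n ≤ V.valuation w := by
    by_contra! h
    refine Set.infinite_range_of_injective hanti.injective (hfin.subset ?_)
    rintro _ ⟨n, rfl⟩
    exact ⟨h n, pow_le_one₀ zero_le hπ1.le⟩
  refine IsDiscreteValuationRing.ofHasUnitMulPowIrreducibleFactorization
    ⟨⟨π, V.mem_of_valuation_le_one _ hπ1.le⟩, ?_, ?_⟩
  · refine ⟨fun h => ?_, fun a b hab => ?_⟩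
    · rw [V.valuation_eq_one_iff] at h
      exact hπ1.ne h
    · by_contra! hab'
      have h1 := hπmax _ ((V.valuation_lt_one_iff a).1 hab'.1)
      have h2 := (V.valuation_lt_one_iff b).1 hab'.2
      have h3 : V.valuation π = V.valuation a * V.valuation b := by
        rw [← map_mul]
        exact congrArg V.valuation (congrArg Subtype.val hab)
      have : V.valuation a * V.valuation b < V.valuation π := by
        calc _ ≤ V.valuation π * V.valuation b := mul_le_mul_left h1 _
          _ < V.valuation π * 1 := mul_lt_mul_of_pos_left h2 hπ0
          _ = _ := mul_one _
      exact this.ne h3.symm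
  · intro f hf
    have hf0 : (f : L) ≠ 0 := fun h => hf (Subtype.ext h)
    -- For the least such $N$, maximality of $\pi$ applied to $f/\pi^{N-1}$ gives equality of
    -- values, so $f$ is a unit times $\pi^N$.
    have hex : ∃ N : ℕ, V.valuation π ^ N ≤ V.valuation (f : L) := by
      obtain ⟨k, hk⟩ := harch f hf0
      refine ⟨n * k, ?_⟩
      rw [pow_mul]
      exact (pow_le_pow_left₀ zero_le hn k).trans hk
    classical
    have hN := Nat.find_spec hex
    have hmin := fun m => @Nat.find_min _ _ hex m
    set N := Nat.find hex
    have hle : V.valuation (f : L) ≤ V.valuation π ^ N := by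
      rcases Nat.eq_zero_or_pos N with h0 | hpos
      · rw [h0, pow_zero]
        exact V.valuation_le_one f
      · have h1 := hmin (N - 1) (by omega)
        rw [not_le] at h1
        have hp : 0 < V.valuation π ^ (N - 1) := pow_pos hπ0 _
        have h2 := hπmax ((f : L) / π ^ (N - 1)) (by
          rw [map_div₀, map_pow]
          exact (div_lt_one₀ hp).2 h1)
        rw [map_div₀, map_pow, div_le_iff₀ hp, ← pow_succ'] at h2
        rwa [Nat.sub_add_cancel hpos] at h2
    have heq := le_antisymm hN hle
    refine ⟨N, ?_⟩
    rw [← map_pow, V.valuation_eq_iff] at heq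
    obtain ⟨a, ha⟩ := heq
    refine Associated.symm ⟨a, Subtype.ext ?_⟩
    push_cast
    rw [← ha, mul_comm]

/-- A valuation ring of a finite extension `L / F` is discrete if the values on `F` are the powers
of a single one. -/
theorem isDiscreteValuationRing_of_finiteDimensional {F : Type*} [Field F] [Algebra F L]
    [FiniteDimensional F L] (V : ValuationSubring L) {w : F} (hw0 : w ≠ 0)
    (hw : V.valuation (algebraMap F L w) < 1)
    (hF : ∀ z : F, z ≠ 0 → ∃ k : ℤ,
      V.valuation (algebraMap F L z) = V.valuation (algebraMap F L w) ^ k) :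
    IsDiscreteValuationRing V := by
  set ω := V.valuation (algebraMap F L w) with hω
  have hω0 : 0 < ω := by simpa [zero_lt_iff, hω] using hw0
  -- Elements whose values lie in different cosets of $\omega^{\mathbb Z}$ are independent over $F$,
  -- so there are at most $[L:F]$ of them.
  have key : ∀ {ι : Type} (a : ι → L), (∀ i, a i ≠ 0) →
      (∀ i j, i ≠ j → ∀ k : ℤ, V.valuation (a i) ≠ ω ^ k * V.valuation (a j)) →
      LinearIndependent F a := by
    intro ι a ha h
    refine V.valuation.linearIndependent_of_ne ha fun i j hij c d hc hd he => ?_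
    obtain ⟨k, hk⟩ := hF c hc
    obtain ⟨l, hl⟩ := hF d hd
    refine h i j hij (l - k) ?_
    rw [map_mul, map_mul, hk, hl] at he
    rw [zpow_sub₀ hω0.ne', div_mul_eq_mul_div, ← he, mul_div_cancel_left₀ _ (zpow_pos hω0 k).ne']
  refine V.isDiscreteValuationRing_of_finite (w := algebraMap F L w) (by simpa using hw0) hw ?_ ?_
  -- Distinct values in $(\omega,1]$ lie in different cosets of $\omega^{\mathbb Z}$.
  · by_contra hinf
    obtain ⟨s, hs, hcard⟩ := Set.Infinite.exists_subset_card_eq hinf (Module.finrank F L + 1)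
    let e := Finset.equivFinOfCardEq hcard
    choose a ha using fun i => V.valuation_surjective (e.symm i : V.ValueGroup)
    have hmem : ∀ i, ω < V.valuation (a i) ∧ V.valuation (a i) ≤ 1 := fun i => by
      rw [ha]
      exact hs (e.symm i).2
    have hne : ∀ i j, ∀ k : ℤ, 0 < k → V.valuation (a i) ≠ ω ^ k * V.valuation (a j) := by
      intro i j k hk he
      refine (hmem i).1.not_ge (he.trans_le ?_)
      calc ω ^ k * V.valuation (a j) ≤ ω ^ k * 1 := mul_le_mul_right (hmem j).2 _
        _ = ω ^ k := mul_one _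
        _ ≤ ω ^ (1 : ℤ) := zpow_right_anti₀ hω0 hw.le hk
        _ = ω := zpow_one _
    have hli := key a (fun i h0 => not_lt_zero (a := ω) (by simpa [h0] using (hmem i).1)) (by
      intro i j hij k he
      rcases lt_trichotomy k 0 with hk | hk | hk
      · refine hne j i (-k) (by omega) ?_
        rw [he, zpow_neg, inv_mul_cancel_left₀ (zpow_pos hω0 k).ne']
      · rw [hk, zpow_zero, one_mul, ha, ha] at he
        exact hij (e.symm.injective (Subtype.ext he))
      · exact hne i j k hk he)
    have := hli.fintype_card_le_finrank
    simp at this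
  · intro f hf
    by_contra! hlt
    have hf0 : 0 < V.valuation f := by simpa [zero_lt_iff] using hf
    have hf1 : V.valuation f < 1 := by simpa using hlt 0
    -- If no power of $\omega$ is below the value of $f$, then no positive power of that value lies
    -- in $\omega^{\mathbb Z}$, and the powers of $f$ are independent.
    have hne : ∀ i j : ℕ, j < i → ∀ k : ℤ,
        V.valuation (f ^ i) ≠ ω ^ k * V.valuation (f ^ j) := by
      intro i j hij k he
      rw [map_pow, map_pow, ← Nat.sub_add_cancel hij.le, pow_add] at he
      have he' := mul_right_cancel₀ (pow_pos hf0 j).ne' he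
      refine (hlt k.toNat).not_ge ?_
      calc ω ^ k.toNat = ω ^ (k.toNat : ℤ) := (zpow_natCast _ _).symm
        _ ≤ ω ^ k := zpow_right_anti₀ hω0 hw.le (Int.self_le_toNat k)
        _ = V.valuation f ^ (i - j) := he'.symm
        _ ≤ V.valuation f ^ 1 := pow_le_pow_of_le_one zero_le hf1.le (by omega)
        _ = _ := pow_one _
    have hli := key (fun i : Fin (Module.finrank F L + 1) => f ^ (i : ℕ))
      (fun i => pow_ne_zero _ hf) (by
      intro i j hij k he
      rcases lt_or_gt_of_ne (Fin.val_ne_of_ne hij) with h | h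
      · refine hne j i h (-k) ?_
        rw [he, zpow_neg, inv_mul_cancel_left₀ (zpow_pos hω0 k).ne']
      · exact hne i j h k he)
    have := hli.fintype_card_le_finrank
    simp at this

end ValuationSubring

/-! ### Existence, extension and restriction of places -/

/-- A field of transcendence degree one is finite over each rational subfield. -/
theorem IsFunctionField.finiteDimensional_adjoin {K F : Type u} [Field K] [Field F] [Algebra K F]
    (hF : IsFunctionField K F) {w : F} (hw : Transcendental K w) :
    FiniteDimensional (IntermediateField.adjoin K {w}) F := by
  obtain ⟨x, -, hfin⟩ := hF
  have halg : Algebra.IsAlgebraic (Algebra.adjoin K {x}) F := by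
    open scoped IntermediateField.algebraAdjoinAdjoin in
    exact (IsFractionRing.comap_isAlgebraic_iff (A := Algebra.adjoin K {x})
      (K := IntermediateField.adjoin K {x}) (C := F)).2 inferInstance
  have htr : Algebra.trdeg K F ≤ 1 := by
    simpa using Algebra.IsAlgebraic.trdeg_le_cardinalMk K ({x} : Set F)
  -- The transcendence degree is at most 1, so $w$ alone is a transcendence basis; an algebraic and
  -- finitely generated extension of $K(w)$ is finite.
  have hli : AlgebraicIndependent K (fun _ : Unit => w) := algebraicIndependent_unique_type_iff.2 hw
  have hb : IsTranscendenceBasis K (fun _ : Unit => w) :=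
    hli.isTranscendenceBasis_of_lift_trdeg_le_of_finite (by simpa using htr)
  have h1 : Algebra.IsAlgebraic (IntermediateField.adjoin K {w}) F := by
    have h := hb.isAlgebraic_field
    rwa [Set.range_const] at h
  have h2 : Algebra.EssFiniteType K (IntermediateField.adjoin K {x}) :=
    IntermediateField.essFiniteType_iff.2 ⟨{x}, by simp⟩
  have h3 : Algebra.EssFiniteType K F := .comp K (IntermediateField.adjoin K {x}) F
  have h4 : Algebra.EssFiniteType (IntermediateField.adjoin K {w}) F := .of_comp K _ F
  exact Algebra.finite_of_essFiniteType_of_isAlgebraic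

namespace Place

variable {K F : Type u} [Field K] [Field F] [Algebra K F]

/-- Every transcendental element of a function field has a zero. -/
theorem exists_val_lt_one (hF : IsFunctionField K F) {w : F} (hw : Transcendental K w) :
    ∃ P : Place K F, P.val w < 1 := by
  have hfin := hF.finiteDimensional_adjoin hw
  let A := (Algebra.adjoin K {w}).toSubring
  let ω : A := ⟨w, Algebra.self_mem_adjoin_singleton K w⟩
  -- If $w\,g(w)=1$, then $Xg-1=0$ by transcendence, which is absurd at $X=0$.
  have hI : Ideal.span {ω} ≠ ⊤ := by
    rw [Ne, Ideal.span_singleton_eq_top]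
    intro h
    obtain ⟨⟨b, hb⟩, hmul⟩ := h.exists_right_inv
    replace hb : b ∈ Algebra.adjoin K {w} := hb
    rw [Algebra.adjoin_singleton_eq_range_aeval] at hb
    obtain ⟨g, rfl⟩ := hb
    have h0 : Polynomial.aeval w (Polynomial.X * g - 1) = 0 := by
      have : w * Polynomial.aeval w g = 1 := congrArg Subtype.val hmul
      simp [this]
    have h1 := (transcendental_iff.1 hw) _ h0
    have := congrArg (Polynomial.eval 0) h1
    simp at this
  obtain ⟨V, hAV, hIV⟩ := Ideal.image_subset_nonunits_valuationSubring _ hI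
  have hV1 : V.valuation w < 1 :=
    V.mem_nonunits_iff.1 (hIV ⟨ω, Ideal.mem_span_singleton_self ω, rfl⟩)
  have hKV : ∀ a : K, algebraMap K F a ∈ V := fun a => hAV (Subalgebra.algebraMap_mem _ a)
  have hVK : ∀ a : K, a ≠ 0 → V.valuation (algebraMap K F a) = 1 := by
    intro a ha
    refine le_antisymm ((V.valuation_le_one_iff _).2 (hKV a)) ?_
    have h := (V.valuation_le_one_iff _).2 (hKV a⁻¹)
    rw [map_inv₀, map_inv₀] at h
    exact (inv_le_one₀ (zero_lt_iff.2 (by simpa using ha))).1 h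
  have hw0 : w ≠ 0 := fun h => hw (h ▸ isAlgebraic_zero)
  -- Write $g=X^kh$ with $h(0)\ne0$; then $h(w)$ has value 1. So the values on $K(w)$ are powers of
  -- that of $w$, and the discreteness criterion applies to $F/K(w)$.
  have hpoly : ∀ g : Polynomial K, g ≠ 0 →
      ∃ k : ℕ, V.valuation (Polynomial.aeval w g) = V.valuation w ^ k := by
    intro g hg
    obtain ⟨h, hgh, hdvd⟩ := Polynomial.exists_eq_pow_rootMultiplicity_mul_and_not_dvd g hg 0
    rw [map_zero, sub_zero, Polynomial.X_dvd_iff] at hdvd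
    refine ⟨g.rootMultiplicity 0, ?_⟩
    have h1 : V.valuation (Polynomial.aeval w h) = 1 := by
      rw [← Polynomial.divX_mul_X_add h, map_add, map_mul, Polynomial.aeval_X, Polynomial.aeval_C,
        V.valuation.map_add_eq_of_lt_right, hVK _ hdvd]
      rw [hVK _ hdvd, map_mul]
      refine mul_lt_one_of_nonneg_of_lt_one_right ?_ zero_le hV1
      exact (V.valuation_le_one_iff _).2
        (hAV (Polynomial.aeval_mem_adjoin_singleton K w))
    nth_rw 1 [hgh]
    rw [map_zero, sub_zero, map_mul, map_mul, h1, mul_one, map_pow, Polynomial.aeval_X, map_pow]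
  have hdvr : IsDiscreteValuationRing V := by
    refine V.isDiscreteValuationRing_of_finiteDimensional (F := IntermediateField.adjoin K {w})
      (w := ⟨w, IntermediateField.mem_adjoin_simple_self K w⟩) ?_ hV1 ?_
    · exact fun h => hw0 (congrArg Subtype.val h)
    · rintro ⟨z, hz⟩ hz0
      obtain ⟨f, g, rfl⟩ := (IntermediateField.mem_adjoin_simple_iff K z).1 hz
      have hz0' : Polynomial.aeval w f / Polynomial.aeval w g ≠ 0 :=
        fun h => hz0 (Subtype.ext h)
      rw [div_ne_zero_iff] at hz0'
      obtain ⟨k, hk⟩ := hpoly f fun h => hz0'.1 (by rw [h, map_zero])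
      obtain ⟨l, hl⟩ := hpoly g fun h => hz0'.2 (by rw [h, map_zero])
      refine ⟨k - l, ?_⟩
      change V.valuation (Polynomial.aeval w f / Polynomial.aeval w g) = V.valuation w ^ _
      rw [map_div₀, hk, hl, zpow_sub₀ (by simpa using hw0), zpow_natCast, zpow_natCast]
  exact ⟨⟨V, hKV, hdvr⟩, (val_lt_one_iff _).2 hV1⟩

/-- A function without poles that vanishes somewhere is zero. -/
theorem eq_zero_of_val_lt_one (hF : IsFunctionField K F) (hFK : IsFullConstantField K F)
    (Q : Place K F) {z : F} (hz : ∀ P ≠ Q, z ∈ P.valRing) (hQ : Q.val z < 1) : z = 0 := by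
  by_contra hz0
  by_cases halg : IsAlgebraic K z
  · obtain ⟨a, rfl⟩ := hFK z halg
    rw [Q.val_algebraMap (fun h => hz0 (by rw [h, map_zero]))] at hQ
    exact lt_irrefl _ hQ
  -- A zero of $1/z$ is a pole of $z$.
  · obtain ⟨P, hP⟩ := exists_val_lt_one hF (w := z⁻¹) (fun h => halg (by simpa using h.inv))
    rw [map_inv₀, inv_lt_one₀ (zero_lt_iff.2 (by simpa using hz0))] at hP
    refine hP.not_ge ?_
    by_cases hPQ : P = Q
    · exact hPQ ▸ hQ.le
    · exact P.val_le_one_iff.2 (hz P hPQ)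

section

variable {E : Type u} [Field E] [Algebra F E] [Algebra K E]

theorem LiesOver.mem_iff {P : Place K E} {Q : Place K F} (h : P.LiesOver Q) (z : F) :
    algebraMap F E z ∈ P.valRing ↔ z ∈ Q.valRing := by
  rw [← h]; rfl

variable [IsScalarTower K F E]

/-- Some valuation ring of $E$ dominates the image of the ring of $Q$. Domination keeps nonunits
nonunits, so its trace on $F$ is not larger, and its values on $F$ are powers of that of a
uniformizer, so it is discrete. -/
theorem exists_liesOver [FiniteDimensional F E] (Q : Place K F) :
    ∃ P : Place K E, P.LiesOver Q := by
  have := Q.isDVR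
  obtain ⟨V, hV, hloc⟩ := (LocalSubring.map (algebraMap F E)
    Q.valRing.toLocalSubring).exists_le_valuationSubring
  have hQV : ∀ z ∈ Q.valRing, algebraMap F E z ∈ V := fun z hz => hV ⟨z, hz, rfl⟩
  have hnon : ∀ z : F, Q.val z < 1 → V.valuation (algebraMap F E z) < 1 := by
    intro z hz
    have hzQ := Q.val_le_one_iff.1 hz.le
    refine lt_of_le_of_ne ((V.valuation_le_one_iff _).2 (hQV z hzQ)) fun h => ?_
    have hmem : algebraMap F E z ∈
      (LocalSubring.map (algebraMap F E) Q.valRing.toLocalSubring).toSubring := ⟨z, hzQ, rfl⟩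
    have hu : IsUnit (⟨_, hmem⟩ :
        (LocalSubring.map (algebraMap F E) Q.valRing.toLocalSubring).toSubring) :=
      hloc.1 _ ((V.valuation_eq_one_iff ⟨_, hQV z hzQ⟩).2 h)
    obtain ⟨⟨_, u, hu, rfl⟩, hzu⟩ := hu.exists_right_inv
    have hzu' : z * u = 1 := (algebraMap F E).injective (by
      rw [map_mul, map_one]
      exact congrArg Subtype.val hzu)
    have := mul_lt_one_of_nonneg_of_lt_one_left zero_le hz (Q.val_le_one_iff.2 hu)
    rw [← map_mul, hzu', map_one] at this
    exact lt_irrefl _ this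
  have hcomap : V.comap (algebraMap F E) = Q.valRing := by
    ext z
    refine ⟨fun h => ?_, hQV z⟩
    by_contra hz
    rw [← val_le_one_iff, not_le] at hz
    have h0 : z ≠ 0 := by
      rintro rfl
      simp at hz
    have := hnon z⁻¹ (by rw [map_inv₀]; exact inv_lt_one_of_one_lt₀ hz)
    rw [map_inv₀, map_inv₀, inv_lt_one₀ (zero_lt_iff.2 (by simpa using h0))] at this
    exact this.not_ge ((V.valuation_le_one_iff _).2 h)
  obtain ⟨ϖ, hϖ⟩ := IsDiscreteValuationRing.exists_irreducible Q.valRing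
  have hunit : ∀ u : Q.valRingˣ, V.valuation (algebraMap F E (u : Q.valRing)) = 1 := by
    intro u
    refine le_antisymm ((V.valuation_le_one_iff _).2 (hQV _ u.1.2)) ?_
    have h1 := (V.valuation_le_one_iff _).2 (hQV _ (u⁻¹ : Q.valRingˣ).1.2)
    have h2 : (u : Q.valRing) * ((u⁻¹ : Q.valRingˣ) : Q.valRing) = (1 : F) :=
      congrArg Subtype.val u.mul_inv
    by_contra! hlt
    have := mul_lt_one_of_nonneg_of_lt_one_left zero_le hlt h1
    rw [← map_mul, ← map_mul, h2, map_one, map_one] at this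
    exact lt_irrefl _ this
  have hdvr : IsDiscreteValuationRing V := by
    refine V.isDiscreteValuationRing_of_finiteDimensional (F := F) (w := (ϖ : F)) ?_ ?_ ?_
    · exact fun h => hϖ.ne_zero (Subtype.ext h)
    · refine hnon _ (Q.val_lt_one_iff.2 ((Q.valRing.valuation_lt_one_iff _).1 ?_))
      exact hϖ.not_isUnit
    · intro z hz
      obtain ⟨n, u, rfl⟩ := IsDiscreteValuationRing.exists_units_eq_smul_zpow_of_irreducible hϖ hz
      refine ⟨n, ?_⟩
      rw [Units.smul_def, Algebra.smul_def, map_mul, map_mul, map_zpow₀, map_zpow₀]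
      erw [hunit u]
      rw [one_mul]
      rfl
  refine ⟨⟨V, fun a => ?_, hdvr⟩, hcomap⟩
  rw [IsScalarTower.algebraMap_apply K F E]
  exact hQV _ (Q.algebraMap_mem a)

/-- The restriction of a place to a subfield. -/
theorem exists_liesOver_restrict [FiniteDimensional F E] (P : Place K E) :
    ∃ Q : Place K F, P.LiesOver Q := by
  have := P.isDVR
  let v := P.val.comap (algebraMap F E)
  have hv : v.valuationSubring = P.valRing.comap (algebraMap F E) := by
    ext z
    exact P.val_le_one_iff
  -- With trivial values on $F$, the powers of a uniformizer at $P$ would all be independent over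
  -- $F$.
  have hnt : v.IsNontrivial := by
    by_contra hv0
    have htriv : ∀ z : F, z ≠ 0 → P.val (algebraMap F E z) = 1 := by
      intro z hz
      by_contra h1
      exact hv0 ⟨z, (map_ne_zero v).2 hz, h1⟩
    obtain ⟨ϖ, hϖ⟩ := IsDiscreteValuationRing.exists_irreducible P.valRing
    have hϖ0 : (ϖ : E) ≠ 0 := fun h => hϖ.ne_zero (Subtype.ext h)
    have hϖ1 : P.val ϖ < 1 :=
      P.val_lt_one_iff.2 ((P.valRing.valuation_lt_one_iff _).1 hϖ.not_isUnit)
    have hli := P.val.linearIndependent_of_ne (F := F)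
      (a := fun i : Fin (Module.finrank F E + 1) => (ϖ : E) ^ (i : ℕ))
      (fun i => pow_ne_zero _ hϖ0) (by
        intro i j hij c d hc hd h
        rw [map_mul, map_mul, htriv c hc, htriv d hd, one_mul, one_mul, map_pow, map_pow] at h
        exact hij (Fin.ext ((pow_right_strictAnti₀
          (zero_lt_iff.2 ((map_ne_zero P.val).2 hϖ0)) hϖ1).injective h)))
    have := hli.fintype_card_le_finrank
    simp at this
  have hdvr : IsDiscreteValuationRing v.valuationSubring := inferInstance
  refine ⟨⟨v.valuationSubring, fun a => ?_, hdvr⟩, hv.symm⟩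
  rw [hv, ValuationSubring.mem_comap, ← IsScalarTower.algebraMap_apply]
  exact P.algebraMap_mem a

end

end Place

/-! ### The Galois action on places -/

namespace Place

section

variable {K F E : Type u} [Field K] [Field F] [Field E] [Algebra K F] [Algebra F E] [Algebra K E]

theorem exists_uniformizer (Q : Place K F) : ∃ w : F, w ≠ 0 ∧ Q.val w < 1 := by
  have := Q.isDVR
  obtain ⟨ϖ, hϖ⟩ := IsDiscreteValuationRing.exists_irreducible Q.valRing
  exact ⟨ϖ, fun h => hϖ.ne_zero (Subtype.ext h),
    Q.val_lt_one_iff.2 ((Q.valRing.valuation_lt_one_iff _).1 hϖ.not_isUnit)⟩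

theorem LiesOver.val_lt_one_iff {P : Place K E} {Q : Place K F} (h : P.LiesOver Q) (z : F) :
    P.val (algebraMap F E z) < 1 ↔ Q.val z < 1 := by
  by_cases hz : z = 0
  · simp [hz]
  rw [← not_le, ← not_le, not_iff_not, ← inv_le_one₀ (by simpa [zero_lt_iff] using hz),
    ← inv_le_one₀ (by simpa [zero_lt_iff] using hz), ← map_inv₀, ← map_inv₀, ← map_inv₀,
    P.val_le_one_iff, Q.val_le_one_iff, h.mem_iff]

theorem LiesOver.mem_of_isIntegralAt {P : Place K E} {Q : Place K F} (h : P.LiesOver Q) {w : E}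
    (hw : Q.IsIntegralAt w) : w ∈ P.valRing := by
  obtain ⟨p, hp, hpw⟩ := hw
  let g : Q.valRing →+* P.valRing :=
    ((algebraMap F E).comp Q.valRing.subtype).codRestrict P.valRing.toSubring
      fun z => (h.mem_iff z).2 z.2
  have : IsIntegral P.valRing w := by
    refine ⟨p.map g, hp.map g, ?_⟩
    rw [Polynomial.eval₂_map]
    exact hpw
  obtain ⟨a, rfl⟩ := IsIntegrallyClosed.isIntegral_iff.1 this
  exact a.2

theorem LiesOver.eq {P : Place K E} {Q Q' : Place K F} (h : P.LiesOver Q) (h' : P.LiesOver Q') :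
    Q = Q' := ext_valRing (h.symm.trans h')

/-- Over a Dedekind ring a place is determined by its center. -/
theorem LiesOver.eq_of_val_lt_one_iff [FiniteDimensional F E] [Algebra.IsSeparable F E]
    {P P' : Place K E} {Q : Place K F} (h : P.LiesOver Q) (h' : P'.LiesOver Q)
    (hc : ∀ a : E, Q.IsIntegralAt a → (P.val a < 1 ↔ P'.val a < 1)) : P = P' := by
  have := Q.isDVR
  let : Algebra Q.valRing E := ((algebraMap F E).comp Q.valRing.subtype).toAlgebra
  have : IsScalarTower Q.valRing F E := .of_algebraMap_eq fun _ => rfl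
  let A := integralClosure Q.valRing E
  have : IsDedekindDomain A := integralClosure.isDedekindDomain Q.valRing F E
  have : IsFractionRing A E := integralClosure.isFractionRing_of_finite_extension F E
  let i : A →+* P.valRing := A.val.toRingHom.codRestrict P.valRing.toSubring
    fun a => h.mem_of_isIntegralAt a.2
  let p : Ideal A := (IsLocalRing.maximalIdeal P.valRing).comap i
  have hp : ∀ a : A, a ∈ p ↔ P.val (a : E) < 1 := by
    intro a
    rw [Ideal.mem_comap, ValuationSubring.valuation_lt_one_iff, P.val_lt_one_iff]
    rfl
  have hp0 : p ≠ ⊥ := by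
    obtain ⟨w, hw0, hw⟩ := Q.exists_uniformizer
    refine (Submodule.ne_bot_iff _).2
      ⟨algebraMap Q.valRing A ⟨w, Q.val_le_one_iff.1 hw.le⟩, (hp _).2 ?_, fun h0 => hw0 ?_⟩
    · exact (h.val_lt_one_iff w).2 hw
    · exact (algebraMap F E).injective (((congrArg Subtype.val h0).trans (map_zero _).symm))
  let v : IsDedekindDomain.HeightOneSpectrum A := ⟨p, Ideal.IsPrime.comap i, hp0⟩
  -- A place over $Q$ with center $p$ has the ring of the $p$-adic valuation: elements integral for
  -- that valuation are fractions $n/d$ with $d\notin p$, and such $d$ are units at $R$.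
  have key : ∀ R : Place K E, R.LiesOver Q → (∀ a : A, a ∈ p ↔ R.val (a : E) < 1) →
      ∀ z, z ∈ R.valRing ↔ v.valuation E z ≤ 1 := by
    intro R hR hpR z
    have hone : ∀ d : p.primeCompl, R.val ((d : A) : E) = 1 := by
      intro d
      refine le_antisymm (R.val_le_one_iff.2 (hR.mem_of_isIntegralAt (d : A).2)) ?_
      rw [← not_lt, ← hpR]
      exact d.2
    constructor
    · intro hz
      by_contra! hlt
      have hz0 : z ≠ 0 := by
        rintro rfl
        simp at hlt
      have hlt' : v.valuation E z⁻¹ < 1 := by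
        rw [map_inv₀]
        exact inv_lt_one_of_one_lt₀ hlt
      obtain ⟨n, d, hnd⟩ := v.exists_primeCompl_mul_eq_of_integer z⁻¹ hlt'.le
      have hn : n ∈ p := by
        have h1 : v.valuation E (algebraMap A E n) < 1 := by
          rw [← hnd, map_mul]
          exact mul_lt_one_of_nonneg_of_lt_one_left zero_le hlt' (v.valuation_le_one _)
        rwa [v.valuation_lt_one_iff_mem] at h1
      have h2 := (hpR n).1 hn
      have h3 : R.val z⁻¹ * R.val ((d : A) : E) = R.val (n : E) := by
        rw [← map_mul]
        exact congrArg R.val hnd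
      rw [hone, mul_one] at h3
      rw [← h3, map_inv₀, inv_lt_one₀ (zero_lt_iff.2 ((map_ne_zero _).2 hz0))] at h2
      exact h2.not_ge (R.val_le_one_iff.2 hz)
    · intro hz
      obtain ⟨n, d, hnd⟩ := v.exists_primeCompl_mul_eq_of_integer z hz
      have h3 : R.val z * R.val ((d : A) : E) = R.val (n : E) := by
        rw [← map_mul]
        exact congrArg R.val hnd
      rw [hone, mul_one] at h3
      rw [← R.val_le_one_iff, h3, R.val_le_one_iff]
      exact hR.mem_of_isIntegralAt n.2
  refine ext_valRing (SetLike.ext fun z => ?_)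
  rw [key P h hp, key P' h' fun a => (hp a).trans (hc a a.2)]

variable [IsScalarTower K F E]

/-- The conjugate `σ⁻¹ P` of a place. -/
def conj (P : Place K E) (σ : E ≃ₐ[F] E) : Place K E where
  valRing := P.valRing.comap (σ : E →+* E)
  algebraMap_mem a := by
    rw [ValuationSubring.mem_comap, IsScalarTower.algebraMap_apply K F E]
    simpa using (IsScalarTower.algebraMap_apply K F E a) ▸ P.algebraMap_mem a
  isDVR := by
    have := P.isDVR
    let e : P.valRing ≃+* P.valRing.comap (σ : E →+* E) :=
      { toFun := fun z => ⟨σ.symm z, by simp [ValuationSubring.mem_comap]⟩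
        invFun := fun z => ⟨σ z, z.2⟩
        left_inv := fun z => by simp
        right_inv := fun z => by simp
        map_mul' := fun z w => Subtype.ext (by simp)
        map_add' := fun z w => Subtype.ext (by simp) }
    exact IsDiscreteValuationRing.RingEquivClass.isDiscreteValuationRing e

theorem mem_conj {P : Place K E} {σ : E ≃ₐ[F] E} {z : E} :
    z ∈ (P.conj σ).valRing ↔ σ z ∈ P.valRing := Iff.rfl

theorem LiesOver.conj {P : Place K E} {Q : Place K F} (h : P.LiesOver Q) (σ : E ≃ₐ[F] E) :
    (P.conj σ).LiesOver Q := by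
  rw [LiesOver, ← h]
  ext z
  rw [ValuationSubring.mem_comap, mem_conj, σ.commutes, ValuationSubring.mem_comap]

theorem conj_val_lt_one_iff {P : Place K E} {σ : E ≃ₐ[F] E} {z : E} :
    (P.conj σ).val z < 1 ↔ P.val (σ z) < 1 := by
  by_cases hz : z = 0
  · simp [hz]
  rw [← not_le, ← not_le, not_iff_not, ← inv_le_one₀ (by simpa [zero_lt_iff] using hz),
    ← inv_le_one₀ (by simpa [zero_lt_iff] using hz), ← map_inv₀, ← map_inv₀, ← map_inv₀,
    val_le_one_iff, val_le_one_iff, mem_conj]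

/-- The Galois group permutes transitively the places over a place. -/
theorem LiesOver.exists_conj_eq [FiniteDimensional F E] [IsGalois F E]
    {P P' : Place K E} {Q : Place K F} (h : P.LiesOver Q) (h' : P'.LiesOver Q) :
    ∃ σ : E ≃ₐ[F] E, P.conj σ = P' := by
  have := Q.isDVR
  let : Algebra Q.valRing E := ((algebraMap F E).comp Q.valRing.subtype).toAlgebra
  have : IsScalarTower Q.valRing F E := .of_algebraMap_eq fun _ => rfl
  let A := integralClosure Q.valRing E
  have : IsFractionRing A E := integralClosure.isFractionRing_of_finite_extension F E
  let i : ∀ R : Place K E, R.LiesOver Q → A →+* R.valRing := fun R hR =>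
    A.val.toRingHom.codRestrict R.valRing.toSubring fun a => hR.mem_of_isIntegralAt a.2
  let p : ∀ R : Place K E, R.LiesOver Q → Ideal A := fun R hR =>
    (IsLocalRing.maximalIdeal R.valRing).comap (i R hR)
  have hp : ∀ R hR (a : A), a ∈ p R hR ↔ R.val (a : E) < 1 := by
    intro R hR a
    rw [Ideal.mem_comap, ValuationSubring.valuation_lt_one_iff, R.val_lt_one_iff]
    rfl
  have hunder : (p P h).under Q.valRing = (p P' h').under Q.valRing := by
    ext z
    exact ((hp P h (algebraMap _ A z)).trans (h.val_lt_one_iff z)).trans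
      ((hp P' h' (algebraMap _ A z)).trans (h'.val_lt_one_iff z)).symm
  have := Algebra.isInvariant_of_isGalois' Q.valRing F E A
  have : Finite (A ≃ₐ[Q.valRing] A) := (galRestrict Q.valRing F E A).toEquiv.finite_iff.1
    inferInstance
  have : (p P h).IsPrime := Ideal.IsPrime.comap _
  have : (p P' h').IsPrime := Ideal.IsPrime.comap _
  -- Transitivity on places follows from transitivity on the primes of the integral closure above a
  -- given prime, since a place is determined by its center. The inverse of $g$ matches the
  -- convention $P\mapsto\sigma^{-1}P$ of `conj`.
  obtain ⟨g, hg⟩ := Algebra.IsInvariant.exists_smul_of_under_eq Q.valRing A (A ≃ₐ[Q.valRing] A)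
    (p P h) (p P' h') hunder
  let σ : E ≃ₐ[F] E := (galRestrict Q.valRing F E A).symm g⁻¹
  have hσ : ∀ a : A, σ a = ((g⁻¹ : A ≃ₐ[Q.valRing] A) a : A) := by
    intro a
    have := algebraMap_galRestrict_apply Q.valRing σ a (B := A)
    rw [show galRestrict Q.valRing F E A σ = g⁻¹ from MulEquiv.apply_symm_apply _ _] at this
    exact this.symm
  refine ⟨σ, (h.conj σ).eq_of_val_lt_one_iff h' fun a ha => ?_⟩
  have h1 := hp P' h' ⟨a, ha⟩
  rw [hg, Ideal.mem_pointwise_smul_iff_inv_smul_mem, hp P h] at h1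
  have h2 : σ a = ((g⁻¹ • (⟨a, ha⟩ : A) : A) : E) := hσ ⟨a, ha⟩
  rw [conj_val_lt_one_iff, h2]
  exact h1

end

end Place

/-! ### Chains of subgroups -/

/-- A commutative group whose order is a product of primes has a chain of subgroups with these
successive indices. -/
theorem exists_subgroup_chain {G : Type*} [Group G] [IsMulCommutative G] [Finite G]
    {r : ℕ} {p : ℕ → ℕ} (hp : ∀ k < r, (p k).Prime)
    (hG : Nat.card G = ∏ k ∈ Finset.range r, p k) :
    ∃ H : ℕ → Subgroup G, H 0 = ⊥ ∧ H r = ⊤ ∧ Monotone H ∧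
      ∀ k < r, (H k).relIndex (H (k + 1)) = p k := by
  -- The order hypotheses sit inside the conclusion, so that the choice is total and the recursion
  -- gives a sequence that is monotone on all of ℕ.
  have hstep : ∀ (k : ℕ) (A : Subgroup G), ∃ A' : Subgroup G, A ≤ A' ∧
      (k < r → Nat.card A = ∏ l ∈ Finset.range k, p l →
        Nat.card A' = ∏ l ∈ Finset.range (k + 1), p l) := by
    intro k A
    by_cases hk : k < r ∧ Nat.card A = ∏ l ∈ Finset.range k, p l
    · obtain ⟨hk, hA⟩ := hk
      have hdvd : p k ∣ Nat.card (G ⧸ A) := by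
        have h1 : (∏ l ∈ Finset.range k, p l) * p k ∣ Nat.card G := by
          rw [hG, ← Finset.prod_range_succ]
          exact Finset.prod_dvd_prod_of_subset _ _ _ (Finset.range_subset_range.2 hk)
        rw [A.card_eq_card_quotient_mul_card_subgroup, hA, mul_comm] at h1
        exact Nat.dvd_of_mul_dvd_mul_right (Finset.prod_pos fun l hl =>
          (hp l ((Finset.mem_range.1 hl).trans hk)).pos) h1
      have := Fact.mk (hp k hk)
      -- Cauchy's theorem in $G/A$; the next subgroup is the preimage of $\langle x\rangle$.
      obtain ⟨x, hx⟩ := exists_prime_orderOf_dvd_card' (p k) hdvd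
      refine ⟨(Subgroup.zpowers x).comap (QuotientGroup.mk' A), ?_, fun _ _ => ?_⟩
      · intro a ha
        rw [Subgroup.mem_comap, QuotientGroup.mk'_apply, (QuotientGroup.eq_one_iff a).2 ha]
        exact one_mem _
      · have h1 := (Subgroup.zpowers x).index_comap_of_surjective (QuotientGroup.mk'_surjective A)
        have h2 := ((Subgroup.zpowers x).comap (QuotientGroup.mk' A)).card_mul_index
        have h3 := (Subgroup.zpowers x).card_mul_index
        have h4 := A.card_eq_card_quotient_mul_card_subgroup
        rw [Nat.card_zpowers, hx] at h3
        rw [h1, h4, ← h3, hA] at h2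
        have h5 : 0 < (Subgroup.zpowers x).index :=
          Nat.pos_of_ne_zero Subgroup.index_ne_zero_of_finite
        rw [Finset.prod_range_succ]
        exact Nat.eq_of_mul_eq_mul_right h5 (by rw [h2]; ring)
    · exact ⟨A, le_rfl, fun h1 h2 => absurd ⟨h1, h2⟩ hk⟩
  choose f hf hf' using hstep
  obtain ⟨H, hH0, hH⟩ : ∃ H : ℕ → Subgroup G, H 0 = ⊥ ∧ ∀ k, H (k + 1) = f k (H k) :=
    ⟨fun k => Nat.rec ⊥ f k, rfl, fun _ => rfl⟩
  have hmono : Monotone H := monotone_nat_of_le_succ fun k => (hf k (H k)).trans_eq (hH k).symm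
  have hcard : ∀ k ≤ r, Nat.card ↥(H k) = ∏ l ∈ Finset.range k, p l := by
    intro k
    induction k with
    | zero => simp [hH0]
    | succ k ih => exact fun hk => hH k ▸ hf' k (H k) hk (ih (by omega))
  refine ⟨H, hH0, ?_, hmono, fun k hk => ?_⟩
  · exact (H r).eq_top_of_card_eq ((hcard r le_rfl).trans hG.symm)
  · have h1 := Subgroup.relIndex_mul_relIndex ⊥ (H k) (H (k + 1)) bot_le (hmono k.le_succ)
    rw [Subgroup.relIndex_bot_left, Subgroup.relIndex_bot_left, hcard k hk.le, hcard (k + 1) hk,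
      Finset.prod_range_succ] at h1
    exact Nat.eq_of_mul_eq_mul_left (Finset.prod_pos fun l hl =>
          (hp l ((Finset.mem_range.1 hl).trans hk)).pos) h1

/-! ### Counting places in the tower -/

section

variable {K F E : Type u} [Field K] [Field F] [Field E] [Algebra K F] [Algebra F E] [Algebra K E]

theorem IsGaloisChain.card_eq {r : ℕ} {p : ℕ → ℕ} {G : ℕ → Subgroup (E ≃ₐ[F] E)}
    (hG : IsGaloisChain r p G) : ∀ k ≤ r, Nat.card (G k) = ∏ l ∈ Finset.range k, p l
  | 0, _ => by simp [hG.zero]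
  | k + 1, hk => by
    rw [Finset.prod_range_succ, ← hG.card_eq k (by omega), ← hG.relIndex k hk,
      ← Subgroup.relIndex_bot_left, ← Subgroup.relIndex_bot_left]
    exact (Subgroup.relIndex_mul_relIndex ⊥ (G k) (G (k + 1)) bot_le (hG.mono k.le_succ)).symm

variable [IsScalarTower K F E]

namespace Place

theorem under_conj (P : Place K E) {H : Subgroup (E ≃ₐ[F] E)} {σ : E ≃ₐ[F] E} (hσ : σ ∈ H) :
    (P.conj σ).under (IntermediateField.fixedField H) =
      P.under (IntermediateField.fixedField H) := by
  ext z
  refine and_congr_left fun hz => ?_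
  change σ z ∈ P.valRing ↔ z ∈ P.valRing
  rw [show σ z = z from hz ⟨σ, hσ⟩]

variable [FiniteDimensional F E] [IsGalois F E]


/-- By transitivity the orbit map is onto the places above $Q$, and complete splitting makes both
sides have $m$ elements. -/
theorem SplitsCompletely.conj_injective {Q : Place K F} (hQ : Q.SplitsCompletely E)
    {P : Place K E} (hP : P.LiesOver Q) :
    Function.Injective fun σ : E ≃ₐ[F] E => P.conj σ := by
  let f : (E ≃ₐ[F] E) → {P : Place K E | P.LiesOver Q} := fun σ => ⟨P.conj σ, hP.conj σ⟩
  have hf : Function.Surjective f := by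
    rintro ⟨P', hP'⟩
    obtain ⟨σ, hσ⟩ := hP.exists_conj_eq hP'
    exact ⟨σ, Subtype.ext hσ⟩
  have hb := hf.bijective_of_nat_card_le (by
    rw [IsGalois.card_aut_eq_finrank, ← hQ.1]
    exact (Nat.card_coe_set_eq _).ge)
  exact fun σ τ h => hb.1 (Subtype.ext h)

end Place

variable [FiniteDimensional F E] [IsGalois F E]

variable {𝓠 : Finset (Place K F)} {𝓟 : Finset (Place K E)}

theorem card_places_eq (h𝓠 : ∀ Q ∈ 𝓠, Q.SplitsCompletely E)
    (h𝓟 : ∀ P, P ∈ 𝓟 ↔ ∃ Q ∈ 𝓠, P.LiesOver Q) :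
    𝓟.card = Module.finrank F E * 𝓠.card := by
  choose R hR using fun Q : Place K F => Place.exists_liesOver (E := E) Q
  let f : (E ≃ₐ[F] E) × 𝓠 → 𝓟 := fun x =>
    ⟨(R x.2).conj x.1, (h𝓟 _).2 ⟨x.2, x.2.2, (hR x.2).conj x.1⟩⟩
  have hf : Function.Bijective f := by
    constructor
    · rintro ⟨σ, Q⟩ ⟨τ, Q'⟩ h
      have h1 : (R Q).conj σ = (R Q').conj τ := congrArg Subtype.val h
      have h2 : (Q : Place K F) = Q' := ((hR Q).conj σ).eq (h1 ▸ (hR Q').conj τ)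
      obtain rfl := Subtype.ext h2
      rw [(h𝓠 Q Q.2).conj_injective (hR Q) h1]
    · rintro ⟨P, hP⟩
      obtain ⟨Q, hQ, hPQ⟩ := (h𝓟 P).1 hP
      obtain ⟨σ, hσ⟩ := (hR Q).exists_conj_eq hPQ
      exact ⟨(σ, ⟨Q, hQ⟩), Subtype.ext hσ⟩
  have := Nat.card_eq_of_bijective f hf
  rw [Nat.card_prod, IsGalois.card_aut_eq_finrank] at this
  simpa using this.symm

/-- Conjugating one chosen representative of each point by $H$ yields distinct places: $H$ acts
freely and does not change the restriction to its fixed field. The cost bound needs only this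
inequality. -/
theorem card_placesUnder_mul_le (h𝓠 : ∀ Q ∈ 𝓠, Q.SplitsCompletely E)
    (h𝓟 : ∀ P, P ∈ 𝓟 ↔ ∃ Q ∈ 𝓠, P.LiesOver Q) (H : Subgroup (E ≃ₐ[F] E)) :
    Nat.card H * Nat.card (placesUnder 𝓟 (IntermediateField.fixedField H)) ≤ 𝓟.card := by
  choose R hR hR' using fun O : placesUnder 𝓟 (IntermediateField.fixedField H) => O.2
  let f : H × placesUnder 𝓟 (IntermediateField.fixedField H) → 𝓟 := fun x =>
    ⟨(R x.2).conj x.1, (h𝓟 _).2 (by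
      obtain ⟨Q, hQ, h⟩ := (h𝓟 _).1 (hR x.2)
      exact ⟨Q, hQ, h.conj _⟩)⟩
  have hf : Function.Injective f := by
    rintro ⟨σ, O⟩ ⟨τ, O'⟩ h
    have h1 : (R O).conj (σ : E ≃ₐ[F] E) = (R O').conj (τ : E ≃ₐ[F] E) := congrArg Subtype.val h
    have h2 : O = O' := Subtype.ext (by
      rw [← hR' O, ← hR' O']
      exact ((R O).under_conj σ.2).symm.trans
        ((congrArg (fun P => P.under (IntermediateField.fixedField H)) h1).trans
          ((R O').under_conj τ.2)))
    subst h2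
    obtain ⟨Q, hQ, hO⟩ := (h𝓟 _).1 (hR O)
    rw [Subtype.ext ((h𝓠 Q hQ).conj_injective hO h1)]
  have := Nat.card_le_card_of_injective f hf
  rw [Nat.card_prod] at this
  simpa using this

end

/-- An element lies in the integral closure of the valuation ring of `Q` if it is regular at all
places over `Q`. -/
theorem Place.isIntegralAt_of_forall_mem {K F E : Type u} [Field K] [Field F] [Field E]
    [Algebra K F] [Algebra F E] [Algebra K E] [IsScalarTower K F E] [FiniteDimensional F E]
    [IsGalois F E] {Q : Place K F} {f : E} (hf : ∀ P : Place K E, P.LiesOver Q → f ∈ P.valRing) :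
    Q.IsIntegralAt f := by
  obtain ⟨P, hP⟩ := Q.exists_liesOver (E := E)
  have hmem : ∀ σ : E ≃ₐ[F] E, σ f ∈ P.valRing := fun σ => hf _ (hP.conj σ)
  -- The coefficients of $\prod_\sigma(X-\sigma f)$ are Galois invariant, hence in $F$, and regular
  -- at $P$ because every $\sigma f$ is; so they lie in the ring of $Q$.
  have hlift : MulSemiringAction.charpoly (E ≃ₐ[F] E) f ∈
      Polynomial.lifts ((algebraMap F E).comp Q.valRing.subtype) := by
    rw [Polynomial.lifts_iff_coeff_lifts]
    intro n
    obtain ⟨c, hc⟩ : (MulSemiringAction.charpoly (E ≃ₐ[F] E) f).coeff n ∈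
        Set.range (algebraMap F E) :=
      (IsGalois.mem_range_algebraMap_iff_fixed _).2 fun σ =>
        MulSemiringAction.smul_coeff_charpoly f n σ
    refine ⟨⟨c, (hP.mem_iff c).1 ?_⟩, hc⟩
    rw [hc]
    have : MulSemiringAction.charpoly (E ≃ₐ[F] E) f =
        (∏ σ : E ≃ₐ[F] E, (Polynomial.X - Polynomial.C (⟨σ f, hmem σ⟩ : P.valRing))).map
          P.valRing.subtype := by
      rw [Polynomial.map_prod, MulSemiringAction.charpoly_eq]
      refine Finset.prod_congr rfl fun σ _ => ?_
      rw [Polynomial.map_sub, Polynomial.map_X, Polynomial.map_C]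
      rfl
    rw [this, Polynomial.coeff_map]
    exact Subtype.prop _
  obtain ⟨q, hq, -, hqm⟩ := Polynomial.lifts_and_natDegree_eq_and_monic hlift
    (MulSemiringAction.monic_charpoly _ f)
  refine ⟨q, hqm, ?_⟩
  rw [← Polynomial.eval_map, hq, MulSemiringAction.eval_charpoly]

theorem Place.ord_prod {K F : Type u} [Field K] [Field F] [Algebra K F] (P : Place K F)
    {ι : Type*} {s : Finset ι} {f : ι → F} (hf : ∀ i ∈ s, f i ≠ 0) :
    P.ord (∏ i ∈ s, f i) = ∑ i ∈ s, P.ord (f i) := by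
  classical
  induction s using Finset.induction_on with
  | empty => simp [Place.ord]
  | insert a s ha ih =>
    rw [Finset.prod_insert ha, Finset.sum_insert ha, P.ord_mul (hf a (Finset.mem_insert_self a s))
      (Finset.prod_ne_zero_iff.2 fun i hi => hf i (Finset.mem_insert_of_mem hi)),
      ih fun i hi => hf i (Finset.mem_insert_of_mem hi)]

/-! ### Mixed-radix digits -/

section digits

variable {r : ℕ} {p : ℕ → ℕ}

theorem digitSum_eq (i : ∀ k : Fin r, Fin (p k)) :
    digitSum i = (finPiFinEquiv (n := fun k : Fin r => p k) i : ℕ) := by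
  rw [finPiFinEquiv_apply, digitSum]
  refine Finset.sum_congr rfl fun k _ => ?_
  rw [Finset.prod_range]
  rfl

theorem digitSum_injective : Function.Injective (digitSum : (∀ k : Fin r, Fin (p k)) → ℕ) := by
  intro i j h
  rw [digitSum_eq, digitSum_eq] at h
  exact finPiFinEquiv.injective (Fin.ext h)

theorem digitSum_lt (i : ∀ k : Fin r, Fin (p k)) : digitSum i < ∏ k ∈ Finset.range r, p k := by
  rw [digitSum_eq, Finset.prod_range]
  exact Fin.is_lt _

theorem exists_digitSum_eq {n : ℕ} (hn : n < ∏ k ∈ Finset.range r, p k) :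
    ∃ i : ∀ k : Fin r, Fin (p k), digitSum i = n := by
  rw [Finset.prod_range] at hn
  exact ⟨finPiFinEquiv.symm ⟨n, hn⟩, by rw [digitSum_eq, Equiv.apply_symm_apply]⟩

end digits

/-! ### Pole orders of the generators -/

namespace FourProperties

variable {K F E : Type u} [Field K] [Field F] [Field E] [Algebra K F] [Algebra F E] [Algebra K E]
  {y : E} {Pinf : Place K E} {Qinf : Place K F}

section

variable (h : FourProperties y Pinf Qinf)
include h

theorem ne_of_liesOver {P : Place K E} {Q : Place K F} (hP : P.LiesOver Q) (hne : P ≠ Pinf) :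
    Q ≠ Qinf := by
  rintro rfl
  exact hne (h.isTotallyRamified.2.1 P hP)

theorem ne_of_liesOver' {P : Place K E} {Q : Place K F} (hP : P.LiesOver Q) (hne : Q ≠ Qinf) :
    P ≠ Pinf := by
  rintro rfl
  exact hne (hP.eq h.isTotallyRamified.1)

theorem ord_algebraMap (z : F) :
    Pinf.ord (algebraMap F E z) = Module.finrank F E * Qinf.ord z := by
  rw [Place.ord, h.isTotallyRamified.2.2.1 z, WithZero.log_pow, Place.ord]
  simp

theorem isIntegralAt_pow {Q : Place K F} (hQ : Q ≠ Qinf) {i : ℕ} (hi : i < Module.finrank F E) :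
    Q.IsIntegralAt (y ^ i) := (h.isIntegralBasisAt Q hQ).1 ⟨i, hi⟩

/-- Order 0 would make the gcd equal to $m$. For $m=1$ nothing is known about the order of $y$, and
even $y=0$ is possible, hence `hm` here and below. -/
theorem ord_ne_zero (hm : 1 < Module.finrank F E) : Pinf.ord y ≠ 0 := by
  intro h0
  have := h.gcd_eq_one
  rw [h0, Int.gcd_zero_right] at this
  simp at this
  omega

theorem ne_zero (hm : 1 < Module.finrank F E) : y ≠ 0 := by
  rintro rfl
  exact h.ord_ne_zero hm (by simp [Place.ord])

theorem pow_ne_zero {i : ℕ} (hi : i < Module.finrank F E) : y ^ i ≠ 0 := by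
  rcases Nat.eq_zero_or_pos i with rfl | hpos
  · simp
  · exact _root_.pow_ne_zero _ (h.ne_zero (by omega))

theorem mem_of_liesOver {Q : Place K F} (hQ : Q ≠ Qinf) {P : Place K E} (hP : P.LiesOver Q)
    (hm : 1 < Module.finrank F E) : y ∈ P.valRing := by
  simpa using hP.mem_of_isIntegralAt (h.isIntegralAt_pow hQ hm)

variable [FiniteDimensional F E]

theorem towerGen_ne_zero (hm : 1 < Module.finrank F E) (G : ℕ → Subgroup (E ≃ₐ[F] E)) (k : ℕ) :
    towerGen G y k ≠ 0 := by
  have := Fintype.ofFinite (G k)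
  rw [towerGen, finprod_eq_prod_of_fintype, Finset.prod_ne_zero_iff]
  intro σ _
  simpa using h.ne_zero hm

variable [IsScalarTower K F E]

/-- Outside $P_\infty$ the function $y$ is regular; a positive order at $P_\infty$ would make it a
function without poles that has a zero. -/
theorem ord_neg (hE : IsFunctionField K E) (hEK : IsFullConstantField K E)
    (hm : 1 < Module.finrank F E) : Pinf.ord y < 0 := by
  by_contra! hge
  have hpos : 0 < Pinf.ord y := lt_of_le_of_ne hge (h.ord_ne_zero hm).symm
  refine h.ne_zero hm (Place.eq_zero_of_val_lt_one hE hEK Pinf (fun P hP => ?_) ?_)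
  · obtain ⟨Q, hQ⟩ := P.exists_liesOver_restrict (F := F)
    exact h.mem_of_liesOver (h.ne_of_liesOver hQ hP) hQ hm
  · rw [Pinf.val_eq_exp (h.ne_zero hm), ← WithZero.exp_zero, WithZero.exp_lt_exp]
    omega

/-- As $y$ has a pole, $ay$ dominates the constant $b$ in $\sigma(y)=ay+b$. -/
theorem ord_conj (hE : IsFunctionField K E) (hEK : IsFullConstantField K E)
    (hm : 1 < Module.finrank F E) (σ : E ≃ₐ[F] E) : Pinf.ord (σ y) = Pinf.ord y := by
  obtain ⟨a, b, ha, hσ⟩ := h.conj_affine σ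
  have hy : 1 < Pinf.val y := by
    rw [Pinf.val_eq_exp (h.ne_zero hm), ← WithZero.exp_zero, WithZero.exp_lt_exp]
    have := h.ord_neg hE hEK hm
    omega
  have h1 : Pinf.val (algebraMap K E a * y) = Pinf.val y := by
    rw [map_mul, Pinf.val_algebraMap ha, one_mul]
  rw [Place.ord, Place.ord, hσ, Pinf.val.map_add_eq_of_lt_left, h1]
  rw [h1]
  exact (Pinf.val_le_one_iff.2 (Pinf.algebraMap_mem b)).trans_lt hy

theorem ord_towerGen (hE : IsFunctionField K E) (hEK : IsFullConstantField K E)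
    (hm : 1 < Module.finrank F E) (G : ℕ → Subgroup (E ≃ₐ[F] E)) (k : ℕ) :
    Pinf.ord (towerGen G y k) = Nat.card (G k) * Pinf.ord y := by
  have := Fintype.ofFinite (G k)
  rw [towerGen, finprod_eq_prod_of_fintype, Pinf.ord_prod fun σ _ => by simpa using h.ne_zero hm,
    Finset.sum_congr rfl fun (σ : G k) _ => h.ord_conj hE hEK hm σ, Finset.sum_const,
    Finset.card_univ, Nat.card_eq_fintype_card, nsmul_eq_mul]

end

end FourProperties

theorem one_lt_of_eq_prod_primes {r m : ℕ} {p : ℕ → ℕ} (hp : ∀ k < r, (p k).Prime)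
    (hm : m = ∏ k ∈ Finset.range r, p k) {k : ℕ} (hk : k < r) : 1 < m := by
  rw [hm]
  exact (hp k hk).one_lt.trans_le (Nat.le_of_dvd
    (Finset.prod_pos fun l hl => (hp l (Finset.mem_range.1 hl)).pos)
    (Finset.dvd_prod_of_mem _ (Finset.mem_range.2 hk)))

/-! ### Pole numbers -/

namespace Place

variable {K F : Type u} [Field K] [Field F] [Algebra K F] {Q : Place K F} {z : F} {j : ℕ}

theorem HasPoleDivisor.mem (h : Q.HasPoleDivisor z j) {P : Place K F} (hP : P ≠ Q) :
    z ∈ P.valRing := by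
  have := h.2 P
  rw [Finsupp.single_eq_of_ne hP] at this
  exact (P.ord_nonneg_iff h.1).1 (by omega)

theorem ord_nonpos (hF : IsFunctionField K F) (hFK : IsFullConstantField K F) (hz0 : z ≠ 0)
    (hz : ∀ P ≠ Q, z ∈ P.valRing) : Q.ord z ≤ 0 := by
  by_contra! hpos
  refine hz0 (eq_zero_of_val_lt_one hF hFK Q hz ?_)
  rw [Q.val_eq_exp hz0, ← WithZero.exp_zero, WithZero.exp_lt_exp]
  omega

/-- The pole divisor only gives $\max(0,-\nu_Q(z))=j$; for $j=0$ a zero at $Q$ has to be excluded.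
-/
theorem HasPoleDivisor.ord_eq (hF : IsFunctionField K F) (hFK : IsFullConstantField K F)
    (h : Q.HasPoleDivisor z j) : Q.ord z = -j := by
  have h1 := h.2 Q
  have h2 := ord_nonpos hF hFK h.1 fun P hP => h.mem hP
  rw [Finsupp.single_eq_same] at h1
  omega

theorem exists_hasPoleDivisor (hF : IsFunctionField K F) (hFK : IsFullConstantField K F)
    (hz0 : z ≠ 0) (hz : ∀ P ≠ Q, z ∈ P.valRing) :
    ∃ j : ℕ, Q.HasPoleDivisor z j ∧ Q.ord z = -j := by
  have h := ord_nonpos hF hFK hz0 hz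
  refine ⟨(-Q.ord z).toNat, ⟨hz0, fun P => ?_⟩, by omega⟩
  by_cases hP : P = Q
  · subst hP
    rw [Finsupp.single_eq_same]
    omega
  · rw [Finsupp.single_eq_of_ne hP]
    have := (P.ord_nonneg_iff hz0).2 (hz P hP)
    omega

end Place

/-! ### The basis of the Riemann–Roch space -/

namespace FourProperties

variable {K F E : Type u} [Field K] [Field F] [Field E] [Algebra K F] [Algebra F E] [Algebra K E]
  {y : E} {Pinf : Place K E} {Qinf : Place K F}
  (h : FourProperties y Pinf Qinf)
include h

/-- Two terms `c y^i`, `c' y^i'` with `i ≠ i'` have different valuations at `Pinf`. -/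
theorem eq_of_ord_eq {i i' : ℕ} (hi : i < Module.finrank F E) (hi' : i' < Module.finrank F E)
    {a b : ℤ} (he : Module.finrank F E * a + i * Pinf.ord y =
      Module.finrank F E * b + i' * Pinf.ord y) : i = i' := by
  -- $m$ divides $(i'-i)\,\nu_{P_\infty}(y)$ and is coprime to the second factor; moreover
  -- $|i'-i|<m$.
  have h1 : (Module.finrank F E : ℤ) ∣ (i' - i : ℤ) := by
    refine Int.dvd_of_dvd_mul_left_of_gcd_one (b := i' - i) (c := Pinf.ord y) ?_ h.gcd_eq_one
    exact ⟨a - b, by linarith⟩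
  have h2 := Int.eq_zero_of_abs_lt_dvd h1 (by rw [abs_lt]; omega)
  omega

variable [FiniteDimensional F E]

theorem linearIndependent_pow :
    LinearIndependent F fun i : Fin (Module.finrank F E) => y ^ (i : ℕ) := by
  have hy : IsIntegral F y := IsIntegral.of_finite F y
  have : (minpoly F y).natDegree = Module.finrank F E := by
    rw [← IntermediateField.adjoin.finrank hy, h.adjoin_eq_top, IntermediateField.finrank_top']
  rw [← this]
  exact _root_.linearIndependent_pow y

variable [IsScalarTower K F E]

/-- The pole numbers of `Pinf` are of the form `i d + j m`. -/
theorem exists_ord_eq (hF : IsFunctionField K F) (hFK : IsFullConstantField K F)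
    {f : E} (hf0 : f ≠ 0) (hf : ∀ P ≠ Pinf, f ∈ P.valRing) :
    ∃ i < Module.finrank F E, ∃ j ∈ Qinf.weierstrassSemigroup,
      -Pinf.ord f = i * -Pinf.ord y + j * Module.finrank F E := by
  classical
  have := h.isAbelian
  have : Nonempty (Fin (Module.finrank F E)) := ⟨⟨0, Module.finrank_pos⟩⟩
  let B := basisOfLinearIndependentOfCardEqFinrank h.linearIndependent_pow (by simp)
  have hB : ∀ i, B i = y ^ (i : ℕ) := fun i => by simp [B]
  have hsum : ∑ i, algebraMap F E (B.repr f i) * y ^ (i : ℕ) = f := by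
    conv_rhs => rw [← B.sum_repr f]
    exact Finset.sum_congr rfl fun i _ => by rw [hB, Algebra.smul_def]
  -- As $f$ is regular at every place above $Q$, it is integral at $Q$; by uniqueness its
  -- coordinates over $F$ are those in the integral basis.
  have hc : ∀ i, ∀ Q ≠ Qinf, B.repr f i ∈ Q.valRing := by
    intro i Q hQ
    have hint : Q.IsIntegralAt f := Place.isIntegralAt_of_forall_mem fun P hP =>
      hf P (h.ne_of_liesOver' hP hQ)
    obtain ⟨c, hc, -⟩ := (h.isIntegralBasisAt Q hQ).2 f hint
    have : B.repr f i = c i := by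
      have h1 : f = ∑ i, (c i : F) • B i := by
        rw [hc]
        exact Finset.sum_congr rfl fun i _ => by rw [hB, Algebra.smul_def]
      rw [h1, B.repr_sum_self]
    rw [this]
    exact (c i).2
  have hord : ∀ i, B.repr f i ≠ 0 → Pinf.ord (algebraMap F E (B.repr f i) * y ^ (i : ℕ)) =
      Module.finrank F E * Qinf.ord (B.repr f i) + (i : ℕ) * Pinf.ord y := by
    intro i hi
    rw [Pinf.ord_mul (by simpa using hi) (h.pow_ne_zero i.2), h.ord_algebraMap, Pinf.ord_pow]
  have hsum' : ∑ i with B.repr f i ≠ 0, algebraMap F E (B.repr f i) * y ^ (i : ℕ) = f := by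
    conv_rhs => rw [← hsum]
    refine Finset.sum_filter_of_ne fun i _ h0 h1 => h0 ?_
    rw [h1, map_zero, zero_mul]
  -- The nonzero terms have distinct values at $P_\infty$, so one of them has the order of $f$; its
  -- coefficient provides the pole number $j$.
  obtain ⟨i, hi, hv, -⟩ := Pinf.val.exists_map_sum_eq (s := {i | B.repr f i ≠ 0})
    (f := fun i => algebraMap F E (B.repr f i) * y ^ (i : ℕ)) (by
      rw [Finset.nonempty_iff_ne_empty]
      intro h0
      rw [h0, Finset.sum_empty] at hsum'
      exact hf0 hsum'.symm) (by
      intro i hi j hj hij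
      simp only [Finset.coe_filter, Set.mem_ofPred_eq, Finset.mem_univ, true_and] at hi hj
      have h1 : Pinf.ord (algebraMap F E (B.repr f i) * y ^ (i : ℕ)) =
        Pinf.ord (algebraMap F E (B.repr f j) * y ^ (j : ℕ)) :=
          congrArg (fun g => -WithZero.log g) hij
      rw [hord i hi, hord j hj] at h1
      exact Fin.ext (h.eq_of_ord_eq i.2 j.2 h1))
  rw [Finset.mem_filter] at hi
  rw [hsum'] at hv
  have h1 : Pinf.ord f = _ := congrArg (fun g => -WithZero.log g) hv
  obtain ⟨j, hj, hj'⟩ := Place.exists_hasPoleDivisor hF hFK hi.2 (hc i)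
  refine ⟨i, i.2, j, ⟨_, hj⟩, ?_⟩
  have h2 := hord i hi.2
  rw [hj'] at h2
  rw [h1]
  change -Pinf.ord (algebraMap F E (B.repr f i) * y ^ (i : ℕ)) = _
  rw [h2]
  ring

section basis

variable {r : ℕ} {p : ℕ → ℕ} {G : ℕ → Subgroup (E ≃ₐ[F] E)} {t : ℕ → F} {lam : ℕ}

/-- For $r=0$ the sign of $d$ is unknown, but the only digit sum is 0. -/
theorem digitSum_mul_nonneg
    (hE : IsFunctionField K E) (hEK : IsFullConstantField K E)
    (hp : ∀ k < r, (p k).Prime)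
    (hm : Module.finrank F E = ∏ k ∈ Finset.range r, p k)
    (i : ∀ k : Fin r, Fin (p k)) : 0 ≤ (digitSum i : ℤ) * -Pinf.ord y := by
  rcases Nat.eq_zero_or_pos r with rfl | hr
  · simp [digitSum]
  · have := h.ord_neg hE hEK (one_lt_of_eq_prod_primes hp hm hr)
    exact mul_nonneg (by positivity) (by omega)

theorem basisFun_ne_zero
    (hp : ∀ k < r, (p k).Prime)
    (hm : Module.finrank F E = ∏ k ∈ Finset.range r, p k)
    (ht : ∀ j ∈ Qinf.weierstrassSemigroup, Qinf.HasPoleDivisor (t j) j)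
    (b : BasisIndex r p Qinf (-Pinf.ord y) (Module.finrank F E) lam) :
    basisFun G y t b ≠ 0 := by
  refine mul_ne_zero (Finset.prod_ne_zero_iff.2 fun k _ => ?_) ?_
  · exact _root_.pow_ne_zero _ (h.towerGen_ne_zero (one_lt_of_eq_prod_primes hp hm k.2) G k)
  · simpa using (ht _ b.2.1).1

/-- Since $|G_k|=p_1\cdots p_k$, the factor $y_k^{i_k}$ contributes $i_k\,p_1\cdots p_k\,d$, and
these add up to $id$. -/
theorem ord_basisFun
    (hF : IsFunctionField K F) (hFK : IsFullConstantField K F)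
    (hE : IsFunctionField K E) (hEK : IsFullConstantField K E)
    (hp : ∀ k < r, (p k).Prime)
    (hm : Module.finrank F E = ∏ k ∈ Finset.range r, p k)
    (hG : IsGaloisChain r p G)
    (ht : ∀ j ∈ Qinf.weierstrassSemigroup, Qinf.HasPoleDivisor (t j) j)
    (b : BasisIndex r p Qinf (-Pinf.ord y) (Module.finrank F E) lam) :
    Pinf.ord (basisFun G y t b) =
      -(digitSum b.1.1 * -Pinf.ord y + b.1.2.down * Module.finrank F E) := by
  have h0 : ∀ k : Fin r, towerGen G y k ^ (b.1.1 k : ℕ) ≠ 0 := fun k =>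
    _root_.pow_ne_zero _ (h.towerGen_ne_zero (one_lt_of_eq_prod_primes hp hm k.2) G k)
  rw [basisFun, Pinf.ord_mul (Finset.prod_ne_zero_iff.2 fun k _ => h0 k)
    (by simpa using (ht _ b.2.1).1), h.ord_algebraMap, (ht _ b.2.1).ord_eq hF hFK,
    Pinf.ord_prod fun k _ => h0 k]
  have : ∀ k : Fin r, Pinf.ord (towerGen G y k ^ (b.1.1 k : ℕ)) =
      ((b.1.1 k : ℕ) * ∏ l ∈ Finset.range k, p l : ℕ) * Pinf.ord y := by
    intro k
    rw [Pinf.ord_pow, h.ord_towerGen hE hEK (one_lt_of_eq_prod_primes hp hm k.2),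
      hG.card_eq k k.2.le]
    push_cast
    ring
  rw [Finset.sum_congr rfl fun k _ => this k, ← Finset.sum_mul, ← Nat.cast_sum]
  change (digitSum b.1.1 : ℤ) * _ + _ = _
  ring

theorem towerGen_mem {P : Place K E} {Q : Place K F} (hPQ : P.LiesOver Q) (hQ : Q ≠ Qinf)
    (hm1 : 1 < Module.finrank F E) (k : ℕ) : towerGen G y k ∈ P.valRing := by
  have := Fintype.ofFinite (G k)
  rw [towerGen, finprod_eq_prod_of_fintype]
  exact prod_mem fun σ _ => h.mem_of_liesOver hQ (hPQ.conj (σ : E ≃ₐ[F] E)) hm1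

theorem basisFun_mem
    (hF : IsFunctionField K F) (hFK : IsFullConstantField K F)
    (hE : IsFunctionField K E) (hEK : IsFullConstantField K E)
    (hp : ∀ k < r, (p k).Prime)
    (hm : Module.finrank F E = ∏ k ∈ Finset.range r, p k)
    (hG : IsGaloisChain r p G)
    (ht : ∀ j ∈ Qinf.weierstrassSemigroup, Qinf.HasPoleDivisor (t j) j)
    (b : BasisIndex r p Qinf (-Pinf.ord y) (Module.finrank F E) lam) :
    basisFun G y t b ∈ Place.riemannRoch (Finsupp.single Pinf (lam : ℤ)) := by
  rw [Place.mem_riemannRoch_single_iff_ord (h.basisFun_ne_zero hp hm ht b),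
    h.ord_basisFun hF hFK hE hEK hp hm hG ht, neg_neg]
  refine ⟨fun P hP => ?_, b.2.2⟩
  obtain ⟨Q, hQ⟩ := P.exists_liesOver_restrict (F := F)
  have hne := h.ne_of_liesOver hQ hP
  refine mul_mem (prod_mem fun k _ => pow_mem ?_ _) ?_
  · exact h.towerGen_mem hQ hne (one_lt_of_eq_prod_primes hp hm k.2) k
  · exact (hQ.mem_iff _).2 ((ht _ b.2.1).mem hne)

/-- The orders $id+jm$ are distinct: coprimality recovers $i$, then $j$ follows, and $i$ determines
its digits. -/
theorem linearIndependent_basisFun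
    (hF : IsFunctionField K F) (hFK : IsFullConstantField K F)
    (hE : IsFunctionField K E) (hEK : IsFullConstantField K E)
    (hp : ∀ k < r, (p k).Prime)
    (hm : Module.finrank F E = ∏ k ∈ Finset.range r, p k)
    (hG : IsGaloisChain r p G)
    (ht : ∀ j ∈ Qinf.weierstrassSemigroup, Qinf.HasPoleDivisor (t j) j) : LinearIndependent K
    (basisFun G y t : BasisIndex r p Qinf (-Pinf.ord y) (Module.finrank F E) lam → E) := by
  refine Pinf.val.linearIndependent_of_ne (h.basisFun_ne_zero hp hm ht) ?_
  intro b b' hne c c' hc hc' he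
  rw [map_mul, map_mul, Pinf.val_algebraMap hc, Pinf.val_algebraMap hc', one_mul, one_mul] at he
  have h1 : Pinf.ord (basisFun G y t b) = Pinf.ord (basisFun G y t b') :=
    congrArg (fun g => -WithZero.log g) he
  rw [h.ord_basisFun hF hFK hE hEK hp hm hG ht, h.ord_basisFun hF hFK hE hEK hp hm hG ht] at h1
  have h2 : digitSum b.1.1 = digitSum b'.1.1 := by
    refine h.eq_of_ord_eq ((digitSum_lt _).trans_eq hm.symm)
      ((digitSum_lt _).trans_eq hm.symm)
      (a := -b.1.2.down) (b := -b'.1.2.down) ?_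
    linarith
  have h3 : b.1.2.down = b'.1.2.down := by
    have hpos : (Module.finrank F E : ℤ) ≠ 0 := by
      exact_mod_cast (Module.finrank_pos (R := F) (M := E)).ne'
    have h4 : (b.1.2.down : ℤ) * Module.finrank F E = b'.1.2.down * Module.finrank F E := by
      rw [h2] at h1
      linarith
    exact_mod_cast mul_right_cancel₀ hpos h4
  exact hne (Subtype.ext (Prod.ext (digitSum_injective h2) (ULift.ext _ _ h3)))

/-- Descent on the pole order at $P_\infty$, which is nonnegative for nonzero functions regular
elsewhere. -/
theorem mem_span_basisFun
    (hF : IsFunctionField K F) (hFK : IsFullConstantField K F)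
    (hE : IsFunctionField K E) (hEK : IsFullConstantField K E)
    (hp : ∀ k < r, (p k).Prime)
    (hm : Module.finrank F E = ∏ k ∈ Finset.range r, p k)
    (hG : IsGaloisChain r p G)
    (ht : ∀ j ∈ Qinf.weierstrassSemigroup, Qinf.HasPoleDivisor (t j) j) {f : E}
    (hf : f ∈ Place.riemannRoch (Finsupp.single Pinf (lam : ℤ))) :
    f ∈ Submodule.span K (Set.range
      (basisFun G y t : BasisIndex r p Qinf (-Pinf.ord y) (Module.finrank F E) lam → E)) := by
  suffices H : ∀ n : ℕ, ∀ f ∈ Place.riemannRoch (Finsupp.single Pinf (lam : ℤ)),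
      f ≠ 0 → -Pinf.ord f < n → f ∈ Submodule.span K (Set.range
      (basisFun G y t : BasisIndex r p Qinf (-Pinf.ord y) (Module.finrank F E) lam → E)) by
    by_cases hf0 : f = 0
    · rw [hf0]
      exact zero_mem _
    · exact H ((-Pinf.ord f).toNat + 1) f hf hf0 (by omega)
  intro n
  induction n with
  | zero =>
    intro f hf hf0 hlt
    have := Place.ord_nonpos hE hEK hf0 ((Place.mem_riemannRoch_single_iff_ord hf0).1 hf).1
    simp only [Nat.cast_zero] at hlt
    omega
  | succ n ih =>
    intro f hf hf0 hlt
    have hf' := (Place.mem_riemannRoch_single_iff_ord hf0).1 hf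
    obtain ⟨i, hi, j, hj, hij⟩ := h.exists_ord_eq hF hFK hf0 hf'.1
    obtain ⟨e, rfl⟩ := exists_digitSum_eq (hm ▸ hi)
    let b : BasisIndex r p Qinf (-Pinf.ord y) (Module.finrank F E) lam :=
      ⟨(e, ⟨j⟩), hj, hij ▸ hf'.2⟩
    set g := basisFun G y t b with hg
    have hg0 : g ≠ 0 := h.basisFun_ne_zero hp hm ht b
    have hgspan : g ∈ Submodule.span K (Set.range
      (basisFun G y t : BasisIndex r p Qinf (-Pinf.ord y) (Module.finrank F E) lam → E)) :=
      Submodule.subset_span ⟨b, rfl⟩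
    have hord : Pinf.ord g = Pinf.ord f := by
      rw [hg, h.ord_basisFun hF hFK hE hEK hp hm hG ht]
      change -(digitSum e * -Pinf.ord y + j * Module.finrank F E) = _
      rw [← hij, neg_neg]
    have hval : Pinf.val g = Pinf.val f := by
      rw [Pinf.val_eq_exp hg0, Pinf.val_eq_exp hf0, hord]
    -- $f/g$ is a unit at the rational place $P_\infty$; with $a$ its residue, $f-ag=(f/g-a)g$ has
    -- smaller pole order than $f$.
    obtain ⟨a, ha⟩ := h.isRational (f / g) (Pinf.val_le_one_iff.1 (by
      rw [map_div₀, hval, div_self ((map_ne_zero _).2 hf0)]))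
    have hlt' : Pinf.val (f - a • g) < Pinf.val f := by
      have : f - a • g = (f / g - algebraMap K E a) * g := by
        rw [sub_mul, div_mul_cancel₀ _ hg0, Algebra.smul_def]
      rw [this, map_mul, hval]
      exact mul_lt_of_lt_one_left (zero_lt_iff.2 ((map_ne_zero _).2 hf0)) ha
    have hmem := sub_mem hf (Submodule.smul_mem _ a (h.basisFun_mem hF hFK hE hEK hp hm hG ht b))
    rw [← sub_add_cancel f (a • g)]
    refine add_mem ?_ (Submodule.smul_mem _ _ hgspan)
    by_cases h0 : f - a • g = 0
    · rw [h0]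
      exact zero_mem _
    · refine ih _ hmem h0 ?_
      rw [Pinf.val_eq_exp h0, Pinf.val_eq_exp hf0, WithZero.exp_lt_exp] at hlt'
      push_cast at hlt
      omega

end basis

end FourProperties

/-! ### Residues along the tower -/

section evaluation

variable {K F E : Type u} [Field K] [Field F] [Field E] [Algebra K F] [Algebra F E] [Algebra K E]

theorem Place.IsRational.of_liesOver [IsScalarTower K F E] {P : Place K E} {Q : Place K F}
    (hPQ : P.LiesOver Q) (hQ : Q.IsRational) (hf : P.HasRelativeDegreeOne Q) : P.IsRational := by
  intro z hz
  obtain ⟨w, hw, hzw⟩ := hf z hz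
  obtain ⟨a, ha⟩ := hQ w hw
  refine ⟨a, ?_⟩
  have := P.val.map_add_lt hzw ((hPQ.val_lt_one_iff _).2 ha)
  rwa [map_sub, ← IsScalarTower.algebraMap_apply, sub_add_sub_cancel] at this

theorem Place.LiesOver.value_algebraMap [IsScalarTower K F E] {P : Place K E} {Q : Place K F}
    (hPQ : P.LiesOver Q) (hQ : Q.IsRational) {z : F} (hz : z ∈ Q.valRing) :
    P.value (algebraMap F E z) = Q.value z := by
  refine P.value_eq ?_
  rw [IsScalarTower.algebraMap_apply K F E, ← map_sub, hPQ.val_lt_one_iff]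
  exact hQ.val_sub_value hz

theorem towerGen_mem_fixedField [FiniteDimensional F E] (G : ℕ → Subgroup (E ≃ₐ[F] E)) (y : E)
    (k : ℕ) : towerGen G y k ∈ IntermediateField.fixedField (G k) := by
  have := Fintype.ofFinite (G k)
  rw [towerGen, finprod_eq_prod_of_fintype]
  intro σ
  change (σ : E ≃ₐ[F] E) (∏ τ : G k, (τ : E ≃ₐ[F] E) y) = _
  rw [map_prod]
  exact Fintype.prod_equiv (Equiv.mulLeft σ) _ _ fun τ => rfl

/-- The field $M$ is closed under inverses, so `residueValue_eq` applies to $P\cap M$; the algorithm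
may therefore work with residues at level $k$. -/
theorem residueValue_under [IsScalarTower K F E] {P : Place K E} (hP : P.IsRational)
    (M : IntermediateField F E) {z : E} (hz : z ∈ P.valRing) (hzM : z ∈ M) :
    residueValue K (P.under M) z = P.value z := by
  refine P.residueValue_eq inf_le_left (fun w hw hw' => ⟨hw', M.inv_mem hw.2⟩) (fun a => ?_)
    ⟨hz, hzM⟩ (hP.val_sub_value hz)
  refine ⟨P.algebraMap_mem a, ?_⟩
  rw [IsScalarTower.algebraMap_apply K F E]
  exact M.algebraMap_mem _

theorem placesUnder.base_eq {𝓟 : Finset (Place K E)} {𝓠 : Finset (Place K F)}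
    (h𝓟 : ∀ P, P ∈ 𝓟 ↔ ∃ Q ∈ 𝓠, P.LiesOver Q) {M : IntermediateField F E}
    {P : Place K E} (hP : P ∈ 𝓟) {Q : Place K F} (hQ : Q ∈ 𝓠) (hPQ : P.LiesOver Q) :
    placesUnder.base h𝓟 (⟨P.under M, P, hP, rfl⟩ : placesUnder 𝓟 M) = ⟨Q, hQ⟩ := by
  have h := Classical.choose_spec (placesUnder.exists_base h𝓟
    (⟨P.under M, P, hP, rfl⟩ : placesUnder 𝓟 M))
  refine Subtype.ext (Place.ext_valRing ?_)
  ext z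
  have h1 : z ∈ (placesUnder.base h𝓟
      (⟨P.under M, P, hP, rfl⟩ : placesUnder 𝓟 M)).1.valRing.toSubring ↔ _ :=
    (SetLike.ext_iff.1 h z)
  rw [← hPQ]
  exact h1.trans ⟨fun hz => hz.1, fun hz => ⟨hz, M.algebraMap_mem z⟩⟩

instance finite_poleIndex (Q : Place K F) (n : ℕ) : Finite (PoleIndex Q n) := by
  refine Finite.of_injective (β := Fin (n + 1)) (fun j => ⟨j.1.down, Nat.lt_succ_of_le j.2.2⟩) ?_
  intro i j hij
  exact Subtype.ext (ULift.ext _ _ (congrArg Fin.val hij))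

end evaluation

/-! ### Correctness and cost of the algorithm -/

section main

variable {K F E : Type u} [Field K] [Field F] [Field E] [Algebra K F] [Algebra F E] [Algebra K E]
  {y : E} {Pinf : Place K E} {Qinf : Place K F}
  {r : ℕ} {p : ℕ → ℕ} {G : ℕ → Subgroup (E ≃ₐ[F] E)} {t : ℕ → F} {lam : ℕ}
  {𝓠 : Finset (Place K F)} {𝓟 : Finset (Place K E)}

open Classical in
/-- The coefficients, extended by zero, of a function with respect to the products of the tower
generators and the `t j`. -/
noncomputable def extendCoeff {d : ℤ} {m : ℕ} (a : BasisIndex r p Qinf d m lam → K)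
    (x : (∀ k : Fin r, Fin (p k)) × PoleIndex Qinf (lam / m)) : K :=
  if h : (digitSum x.1 : ℤ) * d + (x.2.1.down : ℤ) * m ≤ lam then a ⟨(x.1, x.2.1), x.2.2.1, h⟩
  else 0

variable [IsScalarTower K F E]

theorem linearCombination_basisFun {d : ℤ} {m : ℕ} (hm : 0 < m)
    (hd : ∀ i : ∀ k : Fin r, Fin (p k), 0 ≤ (digitSum i : ℤ) * d)
    (a : BasisIndex r p Qinf d m lam →₀ K) :
    Finsupp.linearCombination K (basisFun G y t) a =
      ∑ i : ∀ k : Fin r, Fin (p k), (∏ k : Fin r, towerGen G y k ^ (i k : ℕ)) *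
        algebraMap F E (Finsupp.linearCombination K (fun j : PoleIndex Qinf (lam / m) => t j.1.down)
          (Finsupp.equivFunOnFinite.symm fun j => extendCoeff a (i, j))) := by
  classical
  have := Fintype.ofFinite (PoleIndex Qinf (lam / m))
  -- Because $id\ge0$, the condition $id+jm\le\lambda$ forces $j\le\lfloor\lambda/m\rfloor$. Pairs
  -- outside the image of $e$ have coefficient 0.
  let e : BasisIndex r p Qinf d m lam → (∀ k : Fin r, Fin (p k)) × PoleIndex Qinf (lam / m) :=
    fun b => (b.1.1, ⟨b.1.2, b.2.1, by
      have h1 := hd b.1.1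
      have h2 := b.2.2
      rw [Nat.le_div_iff_mul_le hm]
      zify
      linarith⟩)
  have he : Function.Injective e := by
    intro b b' h
    have h1 : b.1.1 = b'.1.1 := (Prod.ext_iff.1 h).1
    have h2 : b.1.2 = b'.1.2 := congrArg Subtype.val (Prod.ext_iff.1 h).2
    exact Subtype.ext (Prod.ext h1 h2)
  have : Finite (BasisIndex r p Qinf d m lam) := Finite.of_injective e he
  have := Fintype.ofFinite (BasisIndex r p Qinf d m lam)
  rw [Finsupp.linearCombination_apply, Finsupp.sum_fintype _ _ (by simp)]
  have hR : ∀ i : ∀ k : Fin r, Fin (p k), (∏ k : Fin r, towerGen G y k ^ (i k : ℕ)) *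
      algebraMap F E (Finsupp.linearCombination K (fun j : PoleIndex Qinf (lam / m) => t j.1.down)
        (Finsupp.equivFunOnFinite.symm fun j => extendCoeff a (i, j))) =
      ∑ j : PoleIndex Qinf (lam / m), extendCoeff a (i, j) •
        ((∏ k : Fin r, towerGen G y k ^ (i k : ℕ)) * algebraMap F E (t j.1.down)) := by
    intro i
    rw [Finsupp.linearCombination_apply, Finsupp.sum_fintype _ _ (by simp), map_sum,
      Finset.mul_sum]
    refine Finset.sum_congr rfl fun j _ => ?_
    change _ * algebraMap F E (extendCoeff a (i, j) • t j.1.down) = _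
    rw [Algebra.smul_def, Algebra.smul_def, map_mul, ← IsScalarTower.algebraMap_apply,
      mul_left_comm]
  rw [Finset.sum_congr rfl fun i _ => hR i, ← Fintype.sum_prod_type
    (f := fun x : (∀ k : Fin r, Fin (p k)) × PoleIndex Qinf (lam / m) => extendCoeff a x •
        ((∏ k : Fin r, towerGen G y k ^ (x.1 k : ℕ)) * algebraMap F E (t x.2.1.down)))]
  refine Finset.sum_of_injOn e he.injOn (by simp) ?_ ?_
  · intro x _ hx
    rw [extendCoeff, dif_neg, zero_smul]
    intro h
    exact hx ⟨⟨(x.1, x.2.1), x.2.2.1, h⟩, by simp, rfl⟩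
  · intro b _
    rw [extendCoeff, dif_pos b.2.2]
    rfl

variable [FiniteDimensional F E]

theorem computesMPE_divideAndConquer (h : FourProperties y Pinf Qinf)
    (hd : ∀ i : ∀ k : Fin r, Fin (p k), 0 ≤ (digitSum i : ℤ) * -Pinf.ord y)
    (hp : ∀ k < r, (p k).Prime) (hm : Module.finrank F E = ∏ k ∈ Finset.range r, p k)
    (h𝓠 : ∀ Q ∈ 𝓠, Q.IsRational ∧ Q.SplitsCompletely E) (hQinf : Qinf ∉ 𝓠)
    (h𝓟 : ∀ P, P ∈ 𝓟 ↔ ∃ Q ∈ 𝓠, P.LiesOver Q) (hG : IsGaloisChain r p G)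
    (ht : ∀ j ∈ Qinf.weierstrassSemigroup, Qinf.HasPoleDivisor (t j) j)
    {A : Circuit K (PoleIndex Qinf (lam / Module.finrank F E)) 𝓠}
    (hA : ComputesMPE (fun j : PoleIndex Qinf (lam / Module.finrank F E) => t j.1.down) 𝓠 A) :
    ComputesMPE (basisFun G y t) 𝓟
      (divideAndConquer h𝓟 hG y Qinf (-Pinf.ord y) (Module.finrank F E) lam A) := by
  classical
  rintro a ⟨P, hP⟩
  obtain ⟨Q, hQ, hPQ⟩ := (h𝓟 P).1 hP
  have hQne : Q ≠ Qinf := fun h0 => hQinf (h0 ▸ hQ)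
  have hrat : P.IsRational := .of_liesOver hPQ (h𝓠 Q hQ).1 ((h𝓠 Q hQ).2.2 P hPQ).2
  have hwire : ∀ x : (∀ k : Fin r, Fin (p k)) × PoleIndex Qinf (lam / Module.finrank F E),
      Sum.elim a id (if hx : (digitSum x.1 : ℤ) * -Pinf.ord y +
        (x.2.1.down : ℤ) * Module.finrank F E ≤ lam
        then Sum.inl (⟨(x.1, x.2.1), x.2.2.1, hx⟩ :
          BasisIndex r p Qinf (-Pinf.ord y) (Module.finrank F E) lam)
        else Sum.inr 0) = extendCoeff a x := by
    intro x
    rw [extendCoeff]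
    split_ifs <;> rfl
  have heval := eval_fmpe r p (fun k => placesUnder 𝓟 (IntermediateField.fixedField (G k)))
    (fun k => placesUnder_finite 𝓟 _) (fun k => placesUnder.restrict
        (IntermediateField.fixedField_antitone (hG.mono (Nat.le_succ k))))
    (fun k O => residueValue K O.1 (towerGen G y k))
    (A.seq (Circuit.select (placesUnder.base h𝓟)))
    -- The compatible family of points required by `eval_fmpe` is $P\mapsto P\cap E_k$.
    (fun k (P : 𝓟) => ⟨P.1.under (IntermediateField.fixedField (G k)), P.1, P.2, rfl⟩)
    (fun k P => Subtype.ext (by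
      have hle : (IntermediateField.fixedField (G (k + 1))).toSubfield.toSubring ≤
          (IntermediateField.fixedField (G k)).toSubfield.toSubring :=
        IntermediateField.fixedField_antitone (hG.mono (Nat.le_succ k))
      exact (inf_assoc _ _ _).trans (congrArg (P.1.valRing.toSubring ⊓ ·) (inf_eq_right.2 hle))))
    (extendCoeff a) ⟨P, hP⟩
  have hys : ∀ k : Fin r, towerGen G y k ∈ P.valRing := fun k =>
    h.towerGen_mem hPQ hQne (one_lt_of_eq_prod_primes hp hm k.2) k
  have hts : ∀ c : PoleIndex Qinf (lam / Module.finrank F E) →₀ K,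
      Finsupp.linearCombination K (fun j => t j.1.down) c ∈ Q.valRing := by
    intro c
    rw [Finsupp.linearCombination_apply]
    refine sum_mem fun j _ => ?_
    change c j • t j.1.down ∈ Q.valRing
    rw [Algebra.smul_def]
    exact mul_mem (Q.algebraMap_mem _) ((ht _ j.2.1).mem hQne)
  rw [linearCombination_basisFun Module.finrank_pos hd a]
  let s : (∀ k : Fin r, Fin (p k)) → P.valRing := fun i =>
    ⟨algebraMap F E _, (hPQ.mem_iff _).2 (hts (Finsupp.equivFunOnFinite.symm fun j =>
      extendCoeff a (i, j)))⟩
  -- All $y_k$ and all inner functions are regular at $P$ because $Q\ne Q_\infty$, so the evaluation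
  -- homomorphism passes through the whole sum.
  have hφ := map_sum (Place.valueHom hrat)
    (fun i => (∏ k : Fin r, (⟨towerGen G y k, hys k⟩ : P.valRing) ^ (i k : ℕ)) * s i) Finset.univ
  have hval : P.value (∑ i : ∀ k : Fin r, Fin (p k), (∏ k : Fin r, towerGen G y k ^ (i k : ℕ)) *
        algebraMap F E (Finsupp.linearCombination K
          (fun j : PoleIndex Qinf (lam / Module.finrank F E) => t j.1.down)
          (Finsupp.equivFunOnFinite.symm fun j => extendCoeff a (i, j)))) =
      ∑ i, Place.valueHom hrat
        ((∏ k : Fin r, (⟨towerGen G y k, hys k⟩ : P.valRing) ^ (i k : ℕ)) * s i) := by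
    refine Eq.trans ?_ hφ
    change _ = P.value _
    congr 1
    push_cast
    rfl
  refine (Eq.trans ?_ heval).trans (Eq.trans ?_ hval.symm)
  · rw [divideAndConquer]
    simp only [Circuit.eval, Circuit.eval_select, hwire]
    rfl
  refine Finset.sum_congr rfl fun i _ => ?_
  rw [map_mul, map_prod]
  congr 1
  · refine Finset.prod_congr rfl fun k _ => ?_
    rw [map_pow]
    congr 1
    exact residueValue_under hrat _ (hys k) (towerGen_mem_fixedField G y k)
  · change A.eval _ (placesUnder.base h𝓟 _) = P.value (algebraMap F E _)
    rw [placesUnder.base_eq h𝓟 hP hQ hPQ, hPQ.value_algebraMap (h𝓠 Q hQ).1 (hts _)]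
    exact hA (Finsupp.equivFunOnFinite.symm fun j => extendCoeff a (i, j)) ⟨Q, hQ⟩

/-- Level $j$ is entered $|G_j|$ times, and $|G_j|\,|\mathcal P\cap E_j|\le N$ bounds its total cost
by $2p_jN$. -/
theorem cost_divideAndConquer_le [IsGalois F E]
    (hm : Module.finrank F E = ∏ k ∈ Finset.range r, p k)
    (h𝓠 : ∀ Q ∈ 𝓠, Q.SplitsCompletely E)
    (h𝓟 : ∀ P, P ∈ 𝓟 ↔ ∃ Q ∈ 𝓠, P.LiesOver Q) (hG : IsGaloisChain r p G) (d : ℤ)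
    (A : Circuit K (PoleIndex Qinf (lam / Module.finrank F E)) 𝓠) :
    (divideAndConquer h𝓟 hG y Qinf d (Module.finrank F E) lam A).cost ≤
      Module.finrank F E * A.cost + ∑ j ∈ Finset.range r, 2 * p j * 𝓟.card := by
  rw [divideAndConquer]
  simp only [Circuit.cost, Circuit.cost_select, cost_fmpe, zero_add, add_zero]
  rw [← hm]
  refine Nat.add_le_add_left (Finset.sum_le_sum fun j hj => ?_) _
  have := card_placesUnder_mul_le h𝓠 h𝓟 (G j)
  rw [hG.card_eq j (Finset.mem_range.1 hj).le] at this
  calc _ = 2 * p j * ((∏ k ∈ Finset.range j, p k) *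
        Nat.card (placesUnder 𝓟 (IntermediateField.fixedField (G j)))) := by ring
    _ ≤ _ := Nat.mul_le_mul_left _ this

end main

/-- From $2^r\le m$ one gets $r\log2\le\log(ms)$, so the Horner part, at most $2B\,ms\,r$, is at
most $(2/\log2)\,B\,ms\log(ms)$. -/
theorem mul_log_bound {C B : ℝ} (hC : 0 < C) (hB : 0 < B) {r m s c : ℕ} {p : ℕ → ℕ}
    (hp : ∀ k < r, (p k).Prime) (hm : m = ∏ k ∈ Finset.range r, p k)
    (hpB : ∀ k < r, (p k : ℝ) ≤ B) (hc : (c : ℝ) ≤ C * (B * s * Real.log s)) :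
    ((m * c + ∑ j ∈ Finset.range r, 2 * p j * (m * s) : ℕ) : ℝ) ≤
      (C + 2 / Real.log 2) * (B * (m * s : ℕ) * Real.log (m * s : ℕ)) := by
  have hm0 : 0 < m := by
    rw [hm]
    exact Finset.prod_pos fun l hl => (hp l (Finset.mem_range.1 hl)).pos
  have h2m : 2 ^ r ≤ m := by
    rw [hm]
    simpa using Finset.pow_card_le_prod (Finset.range r) p 2
      (fun k hk => (hp k (Finset.mem_range.1 hk)).two_le)
  have hlog2 : 0 < Real.log 2 := Real.log_pos one_lt_two
  -- For $s=0$ the hypothesis on $c$ reads $c\le0$ and the right side vanishes.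
  rcases Nat.eq_zero_or_pos s with rfl | hs
  · simp only [Nat.cast_zero, mul_zero, zero_mul, Finset.sum_const_zero, add_zero,
      Nat.cast_mul] at hc ⊢
    exact mul_nonpos_of_nonneg_of_nonpos (Nat.cast_nonneg _) hc
  have hsm : s ≤ m * s := Nat.le_mul_of_pos_left s hm0
  have hlog : Real.log s ≤ Real.log (m * s : ℕ) :=
    Real.log_le_log (by exact_mod_cast hs) (by exact_mod_cast hsm)
  have hr : r * Real.log 2 ≤ Real.log (m * s : ℕ) := by
    rw [← Real.log_pow]
    refine Real.log_le_log (by positivity) ?_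
    exact_mod_cast h2m.trans (Nat.le_mul_of_pos_right m hs)
  have h1 : (m * c : ℝ) ≤ C * (B * (m * s : ℕ) * Real.log (m * s : ℕ)) := by
    calc (m * c : ℝ) ≤ m * (C * (B * s * Real.log s)) := by gcongr
      _ = C * (B * (m * s : ℕ) * Real.log s) := by push_cast; ring
      _ ≤ _ := by gcongr
  have h2 : ∑ j ∈ Finset.range r, (2 * p j * (m * s) : ℝ) ≤
      2 / Real.log 2 * (B * (m * s : ℕ) * Real.log (m * s : ℕ)) := by
    calc ∑ j ∈ Finset.range r, (2 * p j * (m * s) : ℝ)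
        ≤ ∑ j ∈ Finset.range r, 2 * B * (m * s : ℝ) := by
          refine Finset.sum_le_sum fun j hj => ?_
          have := hpB j (Finset.mem_range.1 hj)
          gcongr
      _ = 2 / Real.log 2 * (B * (m * s : ℕ) * (r * Real.log 2)) := by
          rw [Finset.sum_const, Finset.card_range, nsmul_eq_mul]
          push_cast
          field_simp
      _ ≤ _ := by gcongr
  rw [add_mul, Nat.cast_add]
  refine add_le_add (by exact_mod_cast h1) ?_
  exact_mod_cast h2

theorem mainTheorem3 (C : ℝ) (hC : 0 < C) :
    ∃ C' : ℝ, 0 < C' ∧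
      ∀ (K F E : Type u) [Field K] [Finite K] [Field F] [Field E] [Algebra K F] [Algebra F E]
        [Algebra K E] [IsScalarTower K F E] [FiniteDimensional F E]
        (_hF : IsFunctionField K F) (_hFK : IsFullConstantField K F)
        (_hE : IsFunctionField K E) (_hEK : IsFullConstantField K E)
        (y : E) (Pinf : Place K E) (Qinf : Place K F) (_hP4 : FourProperties y Pinf Qinf)
        (r : ℕ) (p : ℕ → ℕ) (B : ℝ) (_hB : 0 < B) (_hp : ∀ k < r, (p k).Prime)
        (_hm : Module.finrank F E = ∏ k ∈ Finset.range r, p k)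
        (_hpB : ∀ k < r, (p k : ℝ) ≤ B)
        (𝓠 : Finset (Place K F)) (_h𝓠 : ∀ Q ∈ 𝓠, Q.IsRational ∧ Q.SplitsCompletely E)
        (_hQinf : Qinf ∉ 𝓠)
        (𝓟 : Finset (Place K E)) (h𝓟 : ∀ P, P ∈ 𝓟 ↔ ∃ Q ∈ 𝓠, P.LiesOver Q)
        (lam : ℕ) (_hlam : 0 < lam)
        (_hdim : Module.finrank K (Place.riemannRoch (Finsupp.single Pinf (lam : ℤ))) ≤ 𝓟.card),
        𝓟.card = Module.finrank F E * 𝓠.card ∧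
        (∃ G : ℕ → Subgroup (E ≃ₐ[F] E), IsGaloisChain r p G) ∧
        ∀ (G : ℕ → Subgroup (E ≃ₐ[F] E)) (hG : IsGaloisChain r p G)
          (t : ℕ → F) (_ht : ∀ j ∈ Qinf.weierstrassSemigroup, Qinf.HasPoleDivisor (t j) j)
          (A : Circuit K (PoleIndex Qinf (lam / Module.finrank F E)) 𝓠)
          (_hA : ComputesMPE (fun j : PoleIndex Qinf (lam / Module.finrank F E) => t j.1.down) 𝓠 A)
          (_hAcost : (A.cost : ℝ) ≤ C * (B * 𝓠.card * Real.log 𝓠.card)),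
          Encodes (basisFun G y t) 𝓟 (Finsupp.single Pinf (lam : ℤ))
            (divideAndConquer h𝓟 hG y Qinf (-Pinf.ord y) (Module.finrank F E) lam A) ∧
          ((divideAndConquer h𝓟 hG y Qinf (-Pinf.ord y) (Module.finrank F E) lam A).cost : ℝ) ≤
            C' * (B * 𝓟.card * Real.log 𝓟.card) := by
  -- $C$ pays for the calls of the given algorithm, $2/\log2$ for the Horner steps.
  refine ⟨C + 2 / Real.log 2, by have := Real.log_pos one_lt_two; positivity, ?_⟩
  intro K F E _ _ _ _ _ _ _ _ _ hF hFK hE hEK y Pinf Qinf h r p B hB hp hm hpB 𝓠 h𝓠 hQinf 𝓟 h𝓟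
    lam _ _
  have hab := h.isAbelian
  have hN := card_places_eq (fun Q hQ => (h𝓠 Q hQ).2) h𝓟
  refine ⟨hN, ?_, fun G hG t ht A hA hAcost => ⟨?_, ?_⟩⟩
  · obtain ⟨G, h0, hr, hmono, hidx⟩ := exists_subgroup_chain (G := E ≃ₐ[F] E) hp
      ((IsGalois.card_aut_eq_finrank F E).trans hm)
    exact ⟨G, h0, hr, hmono, hidx⟩
  · have hspan : Submodule.span K (Set.range
        (basisFun G y t : BasisIndex r p Qinf (-Pinf.ord y) (Module.finrank F E) lam → E)) =
        Place.riemannRoch (Finsupp.single Pinf (lam : ℤ)) := by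
      refine le_antisymm (Submodule.span_le.2 ?_)
        fun f hf => h.mem_span_basisFun hF hFK hE hEK hp hm hG ht hf
      rintro _ ⟨b, rfl⟩
      exact h.basisFun_mem hF hFK hE hEK hp hm hG ht b
    have hcomp := computesMPE_divideAndConquer h (h.digitSum_mul_nonneg hE hEK hp hm) hp hm h𝓠
      hQinf h𝓟 hG ht hA
    refine ⟨h.linearIndependent_basisFun hF hFK hE hEK hp hm hG ht, hspan, hcomp, ?_⟩
    ext v
    constructor
    · rintro ⟨a, rfl⟩
      refine ⟨_, ?_, funext fun P => hcomp a P⟩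
      rw [← hspan]
      exact Finsupp.mem_span_range_iff_exists_finsupp.2 ⟨a, rfl⟩
    · rintro ⟨f, hf, rfl⟩
      rw [← hspan, Finsupp.mem_span_range_iff_exists_finsupp] at hf
      obtain ⟨a, rfl⟩ := hf
      exact ⟨a, funext fun P => hcomp a P⟩
  · have hcost := cost_divideAndConquer_le (y := y) hm (fun Q hQ => (h𝓠 Q hQ).2) h𝓟 hG
      (-Pinf.ord y) A
    rw [hN] at hcost ⊢
    refine le_trans ?_ (mul_log_bound hC hB hp hm hpB hAcost)
    exact_mod_cast hcost
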